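/- Let $n\ge 1$ be a fixed number of agents. An instance consists of $m\ge 0$ indivisible chores $1,\dots,m$ and of nonnegative integers $c_{ij}$ ($1\le i\le n$, $1\le j\le m$), the cost of chore $j$ for agent $i$; the cost functions are additive, $c_i(S)=\sum_{j\in S}c_{ij}$ for $S\subseteq\{1,\dots,m\}$. An allocation is a partition $(x_1,\dots,x_n)$ of the set of chores into possibly empty bundles, where $x_i$ is given to agent $i$. It is EF1 (envy-free up to one chore) if, for all agents $i,i'$ with $c_i(x_i)>c_i(x_{i'})$, there is a chore $j\in x_i$ with $c_i(x_i\setminus\{j\})\le c_i(x_{i'})$. It is PO (Pareto optimal) if there is no allocation $(y_1,\dots,y_n)$ with $c_i(y_i)\le c_i(x_i)$ for every agent $i$ and $c_{i'}(y_{i'})<c_{i'}(x_{i'})$ for some agent $i'$. Then there are an algorithm and a polynomial $p$, depending only on $n$, such that the algorithm, given any instance with $n$ agents, halts after at most $p(L)$ steps and outputs an allocation that is both EF1 and PO. Here $L$ is the total length of $m$ and of all the costs $c_{ij}$ written in binary, and steps are counted on a random-access machine with logarithmic cost, where every operation is charged the bit lengths of the numbers and addresses involved (a model polynomially equivalent to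 Turing machines). -/

import Mathlib

/-! ## Fair division of indivisible chores

An instance with agents `Fin n` and chores `Fin m` is given by the matrix `c`, where `c i j` is the
cost of chore `j` for agent `i`; cost functions are additive.  An allocation is a map
`x : Fin m → Fin n` sending every chore to the agent who receives it, that is, a partition of the
chores into `n` (possibly empty) bundles. -/

namespace ChoreDivision

/-- The additive cost `c_i(S)` of a set `S` of chores for agent `i`. -/
def cost {n m : ℕ} {R : Type*} [AddCommMonoid R] (c : Fin n → Fin m → R) (i : Fin n)
    (S : Finset (Fin m)) : R :=
  ∑ j ∈ S, c i j

/-- The bundle of agent `i` in the allocation `x`. -/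
def bundle {n m : ℕ} (x : Fin m → Fin n) (i : Fin n) : Finset (Fin m) :=
  Finset.univ.filter (fun j => x j = i)

/-- In the allocation `x`, agent `i` envies agent `i'`. -/
def Envies {n m : ℕ} {R : Type*} [AddCommMonoid R] [LinearOrder R] (c : Fin n → Fin m → R)
    (x : Fin m → Fin n) (i i' : Fin n) : Prop :=
  cost c i (bundle x i') < cost c i (bundle x i)

/-- Envy-freeness up to one chore (EF1). -/
def IsEF1 {n m : ℕ} {R : Type*} [AddCommMonoid R] [LinearOrder R] (c : Fin n → Fin m → R)
    (x : Fin m → Fin n) : Prop :=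
  ∀ i i' : Fin n, Envies c x i i' →
    ∃ j ∈ bundle x i, cost c i (bundle x i \ {j}) ≤ cost c i (bundle x i')

/-- The allocation `y` Pareto dominates the allocation `x`. -/
def Dominates {n m : ℕ} {R : Type*} [AddCommMonoid R] [LinearOrder R] (c : Fin n → Fin m → R)
    (y x : Fin m → Fin n) : Prop :=
  (∀ i, cost c i (bundle y i) ≤ cost c i (bundle x i)) ∧
    ∃ i, cost c i (bundle y i) < cost c i (bundle x i)

/-- Pareto optimality (PO) among (integral) allocations. -/
def IsPO {n m : ℕ} {R : Type*} [AddCommMonoid R] [LinearOrder R] (c : Fin n → Fin m → R)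
    (x : Fin m → Fin n) : Prop :=
  ¬ ∃ y : Fin m → Fin n, Dominates c y x

end ChoreDivision

/-! ## Random-access machine with logarithmic (bit-length) cost

Programs are finite structured programs over a random-access memory whose cells hold natural
numbers.  The memory is divided into arrays; a program names its arrays by constants, so that it
uses only finitely many of them, and it can compute the position inside an array.  Every operation
is charged the bit lengths of all numbers it handles, addresses included, so that the model is
polynomially equivalent to Turing machines. -/

namespace RAM

/-- A memory: `s a k` is the content of cell `k` of array `a`. -/
abbrev State := ℕ → ℕ → ℕ

/-- Arithmetic expressions. -/
inductive Exp : Type where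
  | const : ℕ → Exp
  /-- `read a e` is the content of cell number `e` of array `a`. -/
  | read : ℕ → Exp → Exp
  | add : Exp → Exp → Exp
  /-- Truncated subtraction. -/
  | sub : Exp → Exp → Exp
  | mul : Exp → Exp → Exp
  /-- Integer division (with `x / 0 = 0`). -/
  | div : Exp → Exp → Exp

/-- The value of an expression. -/
def Exp.eval (s : State) : Exp → ℕ
  | .const k => k
  | .read a e => s a (e.eval s)
  | .add e f => e.eval s + f.eval s
  | .sub e f => e.eval s - f.eval s
  | .mul e f => e.eval s * f.eval s
  | .div e f => e.eval s / f.eval s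

/-- The time for evaluating an expression: every operation costs one plus the bit lengths of its
operands; reading a cell costs one plus the bit lengths of its address and of its content. -/
def Exp.time (s : State) : Exp → ℕ
  | .const k => k.size + 1
  | .read a e => e.time s + (e.eval s).size + (s a (e.eval s)).size + 1
  | .add e f => e.time s + f.time s + (e.eval s).size + (f.eval s).size + 1
  | .sub e f => e.time s + f.time s + (e.eval s).size + (f.eval s).size + 1
  | .mul e f => e.time s + f.time s + (e.eval s).size + (f.eval s).size + 1
  | .div e f => e.time s + f.time s + (e.eval s).size + (f.eval s).size + 1

/-- Programs. -/
inductive Program : Type where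
  | skip : Program
  /-- `write a e f` stores the value of `f` in cell number `e` of array `a`. -/
  | write : ℕ → Exp → Exp → Program
  | seq : Program → Program → Program
  /-- `ite e P Q` runs `P` if the value of `e` is nonzero, and `Q` otherwise. -/
  | ite : Exp → Program → Program → Program
  /-- `loop e P` runs `P` as long as the value of `e` is nonzero. -/
  | loop : Exp → Program → Program

/-- The memory after storing `v` in cell `k` of array `a`. -/
def State.set (s : State) (a k v : ℕ) : State :=
  Function.update s a (Function.update (s a) k v)

/-- `Exec P s t T`: started with memory `s`, the program `P` halts after time `T` with
memory `t`. -/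
inductive Exec : Program → State → State → ℕ → Prop where
  | skip (s : State) : Exec .skip s s 1
  | write (a : ℕ) (e f : Exp) (s : State) :
      Exec (.write a e f) s (s.set a (e.eval s) (f.eval s))
        (e.time s + f.time s + (e.eval s).size + (f.eval s).size + 1)
  | seq {P Q : Program} {s t u : State} {T U : ℕ} :
      Exec P s t T → Exec Q t u U → Exec (.seq P Q) s u (T + U)
  | ite_true {e : Exp} {P Q : Program} {s t : State} {T : ℕ} :
      e.eval s ≠ 0 → Exec P s t T → Exec (.ite e P Q) s t (e.time s + (e.eval s).size + 1 + T)
  | ite_false {e : Exp} {P Q : Program} {s t : State} {T : ℕ} :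
      e.eval s = 0 → Exec Q s t T → Exec (.ite e P Q) s t (e.time s + (e.eval s).size + 1 + T)
  | loop_true {e : Exp} {P : Program} {s t u : State} {T U : ℕ} :
      e.eval s ≠ 0 → Exec P s t T → Exec (.loop e P) t u U →
        Exec (.loop e P) s u (e.time s + (e.eval s).size + 1 + T + U)
  | loop_false {e : Exp} {P : Program} {s : State} :
      e.eval s = 0 → Exec (.loop e P) s s (e.time s + (e.eval s).size + 1)

end RAM

/-! ## Instances as inputs, allocations as outputs -/

namespace ChoreDivision

/-- The initial memory for an instance with integer costs: cell 0 of array 0 holds the number `m`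
of chores, array 1 holds the cost matrix row by row (`c i j` in cell `i * m + j`), and all other
cells are 0. -/
def inputState {n m : ℕ} (c : Fin n → Fin m → ℕ) : RAM.State := fun a k =>
  if a = 0 then (if k = 0 then m else 0)
  else if a = 1 then
    (if h : k < n * m then c (Fin.divNat (⟨k, h⟩ : Fin (n * m))) (Fin.modNat ⟨k, h⟩) else 0)
  else 0

/-- The binary length of an instance: the numbers `m` and `c i j` are written in binary, each
followed by a separator. -/
def inputSize {n m : ℕ} (c : Fin n → Fin m → ℕ) : ℕ :=
  (m.size + 1) + ∑ i, ∑ j, ((c i j).size + 1)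

/-- The memory `t` contains the allocation `x` as output: for every chore `j`, cell `j` of array 2
holds the agent who receives `j`. -/
def IsOutput {n m : ℕ} (t : RAM.State) (x : Fin m → Fin n) : Prop :=
  ∀ j : Fin m, t 2 (j : ℕ) = (x j : ℕ)

end ChoreDivision

/-!
**Existence.**  Take logarithmic costs `ℓ i j` and logarithmic weights `u i`, and let each chore go
to an agent whose weighted cost `exp (u i + ℓ i j)` is least; ties leave several such *supported*
allocations.  As the agents' weight ratios run over a cube, the sets of weights for which agent `i`
can be a least spender (have least weighted load) in some supported allocation are closed and
satisfy the boundary condition of a KKM theorem, because an agent with a prohibitively large weight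
receives nothing.  So there are weights for which *every* agent is a least spender in some
supported allocation (`exists_weights_all_least`).  The KKM theorem
(`Sperner.exists_mem_all_of_cover`) is deduced from a parity form of Sperner's lemma on a grid
(`Sperner.odd_full_rooms`).

If the `ℓ i j` are linearly independent over `ℚ`, the ties form a forest, and Hall's theorem matches
the chores with several tied agents to distinct tied agents.  An extremal choice with respect to
this matching turns the allocations above into a single one that is EF1 in weighted costs
(`exists_isWeightedEF1_of_all_least`), hence EF1.  Arbitrary costs are limits of generic ones.  The
perturbation `ε * i * j` of `ℓ i j` ensures that in the limit ties between two agents are broken by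
the index of the chore (`exists_isWeightedEF1`, `exists_supported_ef1`).

**Algorithm.**  For each pair of agents, such an allocation splits the chores of the two agents at a
threshold in the order by cost ratio and index.  Hence it is determined by one chore, or none, for
each pair, and it is among `(m + 1) ^ (n * n)` candidates (`exists_candidate`).  The program tries
all candidates.  It tests EF1 by comparing sums of costs, and it tests for supporting weights, which
imply Pareto optimality, by the Floyd–Warshall recursion for the ratios
`min_{j ∈ x_i} c_{i' j} / c_{i j}`: weights exist iff no cycle of agents has a product below `1`
(`exists_potential`, `one_le_shortest`).  As `n` is fixed, the recursion is a single expression.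

**Running time.**  The program is one loop with a loop-free body.  A loop-free program takes time
linear in the largest bit length in memory (`RAM.Program.LoopFree.exists_exec`), and the loop
invariant `Inv` keeps all bit lengths polynomial.
-/

/-! ### Sperner's lemma on a cube -/

namespace Sperner

open Finset

/-- Room parity: of the `k + 1` facets of a simplex with vertex labels `f i ≤ k`, the number of
those carrying all labels below `k` is odd exactly when the simplex carries all labels. -/
lemma card_doors_of_room (k : ℕ) (f : ℕ → ℕ) (hf : ∀ i ≤ k, f i ≤ k) :
    ((#{i ∈ range (k + 1) | ∀ l < k, ∃ i' ≤ k, i' ≠ i ∧ f i' = l} : ℕ) : ZMod 2) =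
      if ∀ l ≤ k, ∃ i ≤ k, f i = l then 1 else 0 := by
  classical
  split_ifs with hfull
  · have hinj : Set.InjOn f (range (k + 1) : Finset ℕ) := by
      apply Finset.injOn_of_surjOn_of_card_le (t := range (k + 1))
      · intro i hi
        simp only [coe_range, Set.mem_Iio] at hi ⊢
        have := hf i (by lia)
        lia
      · intro l hl
        simp only [coe_range, Set.mem_Iio] at hl
        obtain ⟨i, hi, rfl⟩ := hfull l (by lia)
        exact ⟨i, by simp; lia, rfl⟩
      · simp
    obtain ⟨i0, hi0, h0⟩ := hfull k le_rfl
    have : {i ∈ range (k + 1) | ∀ l < k, ∃ i' ≤ k, i' ≠ i ∧ f i' = l} = {i0} := by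
      ext i
      simp only [mem_filter, mem_range, mem_singleton]
      constructor
      · rintro ⟨hi, h⟩
        by_contra hne
        have hlt : f i < k := by
          have h1 := hf i (by lia)
          rcases h1.lt_or_eq with h1 | h1
          · exact h1
          · exact absurd (hinj (by simp; lia) (by simp; lia) (h1.trans h0.symm)) hne
        obtain ⟨i', hi', hne', h'⟩ := h _ hlt
        exact hne' (hinj (by simp; lia) (by simp; lia) h')
      · rintro rfl
        refine ⟨by lia, fun l hl => ?_⟩
        obtain ⟨i', hi', h'⟩ := hfull l hl.le
        exact ⟨i', hi', by rintro rfl; lia, h'⟩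
    rw [this]; simp
  · rcases Finset.eq_empty_or_nonempty
      {i ∈ range (k + 1) | ∀ l < k, ∃ i' ≤ k, i' ≠ i ∧ f i' = l} with he | ⟨i, hi⟩
    · rw [he]; simp
    · obtain ⟨hik, hd⟩ := mem_filter.1 hi
      simp only [mem_range] at hik
      have hlt : f i < k := by
        rcases (hf i (by lia)).lt_or_eq with h1 | h1
        · exact h1
        · exfalso
          apply hfull
          intro l hl
          rcases hl.lt_or_eq with h2 | h2
          · obtain ⟨i', h3, _, h4⟩ := hd l h2
            exact ⟨i', h3, h4⟩
          · exact ⟨i, by lia, by lia⟩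
      have hsub : range k ⊆ ((range (k + 1)).erase i).image f := by
        intro l hl
        obtain ⟨i', h3, h5, h4⟩ := hd l (by simpa using hl)
        exact mem_image.2 ⟨i', by simp; lia, h4⟩
      have hc : #((range (k + 1)).erase i) = k := by
        rw [card_erase_of_mem (by simp; lia)]; simp
      have hinj : Set.InjOn f ((range (k + 1)).erase i : Finset ℕ) := by
        apply Finset.injOn_of_card_image_eq
        apply le_antisymm card_image_le
        have := card_le_card hsub
        simp at this
        lia
      obtain ⟨i1, h1, h1i, h1f⟩ := hd _ hlt
      have : {i ∈ range (k + 1) | ∀ l < k, ∃ i' ≤ k, i' ≠ i ∧ f i' = l} = {i, i1} := by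
        ext i2
        simp only [mem_filter, mem_range, mem_singleton, mem_insert]
        constructor
        · rintro ⟨h2, h2d⟩
          by_contra hcon
          push Not at hcon
          have h2k : f i2 < k ∨ f i2 = k := (hf i2 (by lia)).lt_or_eq
          rcases h2k with h2k | h2k
          · obtain ⟨i', h3, h4, h5⟩ := h2d _ h2k
            by_cases h6 : i' = i
            · subst h6
              exact hcon.2 (hinj (by simp; lia) (by simp; lia) (by lia))
            · exact h4 (hinj (by simp; lia) (by simp; lia) h5)
          · apply hfull
            intro l hl
            rcases hl.lt_or_eq with h7 | h7
            · obtain ⟨i', h3, _, h4⟩ := hd l h7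
              exact ⟨i', h3, h4⟩
            · exact ⟨i2, by lia, by lia⟩
        · rintro (rfl | rfl)
          · exact ⟨hik, hd⟩
          · refine ⟨by lia, fun l hl => ?_⟩
            obtain ⟨i', h3, h4, h5⟩ := hd l hl
            by_cases h6 : i' = i2
            · subst h6
              exact ⟨i, by lia, h1i.symm, by lia⟩
            · exact ⟨i', h3, h6, h5⟩
      rw [this, card_pair h1i.symm]
      rfl

/-- The rooms of the Freudenthal triangulation of the cube `[0, N]^k`.  A simplex given by its
lowest vertex `v` and an order of the coordinates is encoded as the single vector `k * v + r`, where
`r` ranks the coordinates, the one to be increased last having rank `0`. -/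
def rooms (k N : ℕ) : Finset (Fin k → ℕ) :=
  {z ∈ Fintype.piFinset (fun _ => range (k * N)) | Function.Injective fun c => z c % k}

/-- The vertex number `i ∈ {0, …, k}` of the room `z`. -/
def vertex {k : ℕ} (z : Fin k → ℕ) (i : ℕ) : Fin k → ℕ := fun c => (z c + i) / k

/-- The labels admitted in Sperner's lemma for the cube `[0, N]^k`. -/
def Admissible {k : ℕ} (N : ℕ) (lab : (Fin k → ℕ) → ℕ) : Prop :=
  ∀ v, (∀ c, v c ≤ N) → lab v ≤ k ∧ ∀ c : Fin k, (v c = 0 → lab v ≠ c + 1) ∧ (v c = N → lab v ≠ c)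

/-- The facet of the room `z` opposite to its vertex `i` carries all labels below `k`. -/
def IsDoor {k : ℕ} (lab : (Fin k → ℕ) → ℕ) (z : Fin k → ℕ) (i : ℕ) : Prop :=
  ∀ l < k, ∃ i' ≤ k, i' ≠ i ∧ lab (vertex z i') = l

/-- The room `z` carries all labels. -/
def IsFull {k : ℕ} (lab : (Fin k → ℕ) → ℕ) (z : Fin k → ℕ) : Prop :=
  ∀ l ≤ k, ∃ i ≤ k, lab (vertex z i) = l

lemma mem_rooms {k N : ℕ} {z : Fin k → ℕ} :
    z ∈ rooms k N ↔ (∀ c, z c < k * N) ∧ Function.Injective fun c => z c % k := by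
  simp [rooms]

lemma vertex_le {k N : ℕ} {z : Fin k → ℕ} (hz : z ∈ rooms k N) {i : ℕ} (hi : i ≤ k) (c : Fin k) :
    vertex z i c ≤ N := by
  have hk : 0 < k := c.pos
  have := (mem_rooms.1 hz).1 c
  unfold vertex
  rw [← Nat.lt_succ_iff, Nat.div_lt_iff_lt_mul hk]
  nlinarith

lemma exists_mod_eq {k N : ℕ} {z : Fin k → ℕ} (hz : z ∈ rooms k N) {r : ℕ} (hr : r < k) :
    ∃ c, z c % k = r := by
  have hk : 0 < k := by lia
  have hinj := (mem_rooms.1 hz).2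
  have : Function.Injective (fun c : Fin k => (⟨z c % k, Nat.mod_lt _ hk⟩ : Fin k)) := by
    intro a b hab
    exact hinj (by simpa using hab)
  obtain ⟨c, hc⟩ := (Finite.injective_iff_surjective.1 this) ⟨r, hr⟩
  exact ⟨c, by simpa using hc⟩

/-- Exchange of the residues `t` and `t + 1` modulo `k`, the quotient being kept. -/
def swapResidue (k t a : ℕ) : ℕ :=
  if a % k = t + 1 then a - 1 else if a % k = t then a + 1 else a

lemma swapResidue_spec {k t : ℕ} (ht : t + 1 < k) (a : ℕ) :
    swapResidue k t a / k = a / k ∧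
      swapResidue k t a % k = if a % k = t + 1 then t else if a % k = t then t + 1 else a % k := by
  have h2 := Nat.div_add_mod a k
  have hm := Nat.mod_lt a (show 0 < k by lia)
  have key : ∀ r < k, (k * (a / k) + r) / k = a / k ∧ (k * (a / k) + r) % k = r := by
    intro r hr
    rw [Nat.mul_add_div (by lia), Nat.mul_add_mod, Nat.div_eq_of_lt hr, Nat.mod_eq_of_lt hr]
    simp
  unfold swapResidue
  split_ifs with h h'
  · have : a - 1 = k * (a / k) + t := by lia
    rw [this]; exact key _ (by lia)
  · have : a + 1 = k * (a / k) + (t + 1) := by lia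
    rw [this]; exact key _ (by lia)
  · simp

lemma swapResidue_swapResidue {k t : ℕ} (ht : t + 1 < k) (a : ℕ) :
    swapResidue k t (swapResidue k t a) = a := by
  have h1 := swapResidue_spec ht a
  have h2 := swapResidue_spec ht (swapResidue k t a)
  have h3 : swapResidue k t (swapResidue k t a) % k = a % k := by
    rw [h2.2, h1.2]
    split_ifs <;> lia
  rw [← Nat.div_add_mod (swapResidue k t (swapResidue k t a)) k, h3, h2.1, h1.1, Nat.div_add_mod]

lemma add_swapResidue_div {k t : ℕ} (ht : t + 1 < k) (a i : ℕ) (hi : i ≤ k) (hne : i + (t + 1) ≠ k) :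
    (swapResidue k t a + i) / k = (a + i) / k := by
  have hk : 0 < k := by lia
  have h1 := swapResidue_spec ht a
  have hm := Nat.mod_lt a hk
  have e : ∀ b, (b + i) / k = (b % k + i) / k + b / k := by
    intro b
    conv_lhs => rw [← Nat.div_add_mod b k]
    rw [add_assoc, Nat.mul_add_div hk, add_comm]
  rw [e, e a, h1.1, h1.2]
  congr 1
  split_ifs with h h'
  · rw [h]
    by_cases hh : t + i < k
    · rw [Nat.div_eq_of_lt hh, Nat.div_eq_of_lt (by lia)]
    · rw [Nat.div_eq_of_lt_le (k := 1), Nat.div_eq_of_lt_le (k := 1)] <;> lia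
  · rw [h']
    by_cases hh : t + i < k
    · rw [Nat.div_eq_of_lt hh, Nat.div_eq_of_lt (by lia)]
    · rw [Nat.div_eq_of_lt_le (k := 1), Nat.div_eq_of_lt_le (k := 1)] <;> lia
  · rfl

open Classical in
/-- The doors opposite to an inner vertex come in pairs: exchanging the two coordinates that are
increased just before and just after that vertex leaves the facet unchanged. -/
lemma even_inner_doors {k N : ℕ} (lab : (Fin k → ℕ) → ℕ) {i : ℕ} (hi0 : 0 < i) (hik : i < k) :
    ((#{z ∈ rooms k N | IsDoor lab z i} : ℕ) : ZMod 2) = 0 := by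
  obtain ⟨t, ht⟩ : ∃ t, i + (t + 1) = k := ⟨k - i - 1, by lia⟩
  have htk : t + 1 < k := by lia
  rw [card_eq_sum_ones]
  push_cast
  refine sum_involution (fun z _ c => swapResidue k t (z c)) (fun _ _ => by decide) ?_ ?_ ?_
  · intro z hz _ heq
    obtain ⟨c, hc⟩ := exists_mod_eq (mem_filter.1 hz).1 (show t < k by lia)
    have := congrFun heq c
    simp [swapResidue, hc] at this
  · intro z hz
    obtain ⟨hz, hd⟩ := mem_filter.1 hz
    have hz' := mem_rooms.1 hz
    refine mem_filter.2 ⟨mem_rooms.2 ⟨fun c => ?_, fun a b hab => hz'.2 ?_⟩, fun l hl => ?_⟩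
    · have := hz'.1 c
      have hk : 0 < k := by lia
      rw [mul_comm, ← Nat.div_lt_iff_lt_mul hk] at this ⊢
      rwa [(swapResidue_spec htk _).1]
    · simp only [(swapResidue_spec htk _).2] at hab ⊢
      split_ifs at hab <;> lia
    · obtain ⟨i', h1, h2, h3⟩ := hd l hl
      refine ⟨i', h1, h2, ?_⟩
      rw [← h3]
      congr 1
      ext c
      exact add_swapResidue_div htk _ _ h1 (by lia)
  · intro z _
    ext c
    exact swapResidue_swapResidue htk _

open Classical in
lemma card_door_shift {k N : ℕ} (hk : 0 < k) (lab : (Fin k → ℕ) → ℕ) :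
    #{z ∈ rooms k N | IsDoor lab z 0 ∧ ∀ c, z c + 1 < k * N} =
      #{z ∈ rooms k N | IsDoor lab z k ∧ ∀ c, 0 < z c} := by
  have hmod : ∀ a b : ℕ, a % k = b % k → (a + 1) % k = (b + 1) % k := fun a b h =>
    Nat.ModEq.add_right (n := k) 1 h
  have hmod' : ∀ a b : ℕ, (a + 1) % k = (b + 1) % k → a % k = b % k := fun a b h =>
    Nat.ModEq.add_right_cancel' (n := k) 1 h
  apply card_nbij' (fun z c => z c + 1) (fun z c => z c - 1)
  · intro z hz
    simp only [coe_filter, Set.mem_ofPred_eq, mem_rooms] at hz ⊢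
    obtain ⟨⟨h1, h2⟩, h3, h4⟩ := hz
    refine ⟨⟨h4, fun a b hab => h2 (hmod' _ _ hab)⟩, ?_, fun c => by lia⟩
    intro l hl
    obtain ⟨i', h5, h6, h7⟩ := h3 l hl
    refine ⟨i' - 1, by lia, by lia, ?_⟩
    rw [← h7]
    congr 1
    ext c
    simp only [vertex]
    congr 1
    lia
  · intro z hz
    simp only [coe_filter, Set.mem_ofPred_eq, mem_rooms] at hz ⊢
    obtain ⟨⟨h1, h2⟩, h3, h4⟩ := hz
    refine ⟨⟨fun c => by have := h1 c; lia, fun a b hab => h2 ?_⟩, ?_, fun c => by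
      have := h1 c; have := h4 c; lia⟩
    · have ha := h4 a
      have hb := h4 b
      have := hmod _ _ hab
      simpa [Nat.sub_add_cancel ha, Nat.sub_add_cancel hb] using this
    · intro l hl
      obtain ⟨i', h5, h6, h7⟩ := h3 l hl
      refine ⟨i' + 1, by lia, by lia, ?_⟩
      rw [← h7]
      congr 1
      ext c
      have := h4 c
      simp only [vertex]
      congr 1
      lia
  · intro z _
    ext c; simp
  · intro z hz
    simp only [coe_filter, Set.mem_ofPred_eq, mem_rooms] at hz
    ext c
    have := hz.2.2 c
    simp only
    lia

lemma no_door_top {k N : ℕ} {lab : (Fin k → ℕ) → ℕ} (hlab : Admissible N lab) {z : Fin k → ℕ}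
    (hz : z ∈ rooms k N) (hd : IsDoor lab z 0) (c : Fin k) : z c + 1 < k * N := by
  by_contra hcon
  have hlt := (mem_rooms.1 hz).1 c
  have hk : 0 < k := c.pos
  have hN : 0 < N := by
    rcases Nat.eq_zero_or_pos N with rfl | h
    · simp at hlt
    · exact h
  obtain ⟨i', h1, h2, h3⟩ := hd c c.2
  have hv := vertex_le hz h1
  refine ((hlab _ hv).2 c).2 ?_ h3
  apply le_antisymm (hv c)
  unfold vertex
  rw [Nat.le_div_iff_mul_le hk]
  have : N * k = k * N := mul_comm _ _
  lia

lemma eq_last_of_door_bottom {k N : ℕ} {lab : (Fin k → ℕ) → ℕ} (hlab : Admissible N lab)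
    {z : Fin k → ℕ} (hz : z ∈ rooms k N) (hd : IsDoor lab z k) {c : Fin k} (hc : z c = 0) :
    (c : ℕ) + 1 = k := by
  by_contra hcon
  have h := c.2
  obtain ⟨i', h1, h2, h3⟩ := hd (c + 1) (by lia)
  have hv := vertex_le hz h1
  refine ((hlab _ hv).2 c).1 ?_ h3
  simp only [vertex, hc, zero_add]
  exact Nat.div_eq_of_lt (by lia)

lemma div_mod_lower (k a i : ℕ) (ha : a % (k + 1) ≠ 0) (hi : i ≤ k) :
    (k * (a / (k + 1)) + (a % (k + 1) - 1) + i) / k = (a + i) / (k + 1) := by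
  have h1 := Nat.mod_lt a (Nat.succ_pos k)
  have h2 := Nat.div_add_mod a (k + 1)
  have hk : 0 < k := by lia
  set v := a / (k + 1)
  set r := a % (k + 1)
  have e1 : k * v + (r - 1) + i = (r - 1 + i) + k * v := by ring
  have e2 : a + i = (r + i) + (k + 1) * v := by lia
  rw [e1, e2, Nat.add_mul_div_left _ _ hk, Nat.add_mul_div_left _ _ (Nat.succ_pos k)]
  congr 1
  by_cases h : k < r + i
  · rw [Nat.div_eq_of_lt_le (k := 1), Nat.div_eq_of_lt_le (k := 1)] <;> lia
  · rw [Nat.div_eq_of_lt, Nat.div_eq_of_lt] <;> lia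

open Classical in
/-- The doors on the face where the last coordinate vanishes are the full rooms of that face. -/
lemma card_bottom_doors {k N : ℕ} (hN : 0 < N) {lab : (Fin (k + 1) → ℕ) → ℕ} :
    #{z ∈ rooms (k + 1) N | IsDoor lab z (k + 1) ∧ z (Fin.last k) = 0} =
      #{z ∈ rooms k N | IsFull (fun v => lab (Fin.snoc v 0)) z} := by
  have hvert : ∀ z : Fin (k + 1) → ℕ, z (Fin.last k) = 0 →
      (∀ c : Fin k, z c.castSucc % (k + 1) ≠ 0) → ∀ i ≤ k,
      (Fin.snoc (vertex (fun c : Fin k => k * (z c.castSucc / (k + 1)) +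
        (z c.castSucc % (k + 1) - 1)) i) 0 : Fin (k + 1) → ℕ) = vertex z i := by
    intro z h0 hz i hi
    ext c
    refine Fin.lastCases ?_ (fun c => ?_) c
    · simp only [Fin.snoc_last, vertex, h0, zero_add]
      rw [Nat.div_eq_of_lt (by lia)]
    · simp only [Fin.snoc_castSucc, vertex]
      exact div_mod_lower k _ i (hz c) hi
  have hne : ∀ z ∈ rooms (k + 1) N, z (Fin.last k) = 0 →
      ∀ c : Fin k, z c.castSucc % (k + 1) ≠ 0 := by
    intro z hz h0 c h
    have := (mem_rooms.1 hz).2 (a₁ := c.castSucc) (a₂ := Fin.last k) (by simp [h, h0])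
    exact absurd this (Fin.castSucc_lt_last c).ne
  have hlow : ∀ v r : ℕ, r < k → (k * v + r) / k = v ∧ (k * v + r) % k = r := by
    intro v r hr
    rw [Nat.mul_add_div (by lia), Nat.mul_add_mod, Nat.div_eq_of_lt hr, Nat.mod_eq_of_lt hr]
    simp
  have hup : ∀ v r : ℕ, r < k + 1 →
      ((k + 1) * v + r) / (k + 1) = v ∧ ((k + 1) * v + r) % (k + 1) = r := by
    intro v r hr
    rw [Nat.mul_add_div (by lia), Nat.mul_add_mod, Nat.div_eq_of_lt hr, Nat.mod_eq_of_lt hr]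
    simp
  have hinv : ∀ z : Fin k → ℕ, (fun c : Fin k => k * ((Fin.snoc (fun c => (k + 1) * (z c / k) +
      (z c % k + 1)) 0 : Fin (k + 1) → ℕ) c.castSucc / (k + 1)) +
      ((Fin.snoc (fun c => (k + 1) * (z c / k) + (z c % k + 1)) 0 : Fin (k + 1) → ℕ)
        c.castSucc % (k + 1) - 1)) = z := by
    intro z
    ext c
    have := Nat.mod_lt (z c) c.pos
    simp only [Fin.snoc_castSucc]
    rw [(hup _ _ (by lia)).1, (hup _ _ (by lia)).2, Nat.add_sub_cancel, Nat.div_add_mod]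
  apply card_nbij' (fun z c => k * (z c.castSucc / (k + 1)) + (z c.castSucc % (k + 1) - 1))
    (fun z => (Fin.snoc (fun c => (k + 1) * (z c / k) + (z c % k + 1)) 0 : Fin (k + 1) → ℕ))
  · intro z hz
    simp only [coe_filter, Set.mem_ofPred_eq] at hz ⊢
    obtain ⟨hz, hd, h0⟩ := hz
    have hn := hne z hz h0
    have hz' := mem_rooms.1 hz
    have hr : ∀ c : Fin k, z c.castSucc % (k + 1) - 1 < k := fun c => by
      have := Nat.mod_lt (z c.castSucc) k.succ_pos
      have := hn c
      lia
    refine ⟨mem_rooms.2 ⟨fun c => ?_, fun a b hab => ?_⟩, fun l hl => ?_⟩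
    · have h1 := hz'.1 c.castSucc
      rw [mul_comm, ← Nat.div_lt_iff_lt_mul k.succ_pos] at h1
      have := hr c
      nlinarith
    · simp only [(hlow _ _ (hr _)).2] at hab
      have ha := hn a
      have hb := hn b
      exact Fin.castSucc_injective _ (hz'.2 (by simp only; lia))
    · obtain ⟨i', h1, h2, h3⟩ := hd l (by lia)
      refine ⟨i', by lia, ?_⟩
      exact (congrArg lab (hvert z h0 hn i' (by lia))).trans h3
  · intro z hz
    simp only [coe_filter, Set.mem_ofPred_eq] at hz ⊢
    obtain ⟨hz, hf⟩ := hz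
    have hz' := mem_rooms.1 hz
    have hr : ∀ c, z c % k + 1 < k + 1 := fun c => by
      have := Nat.mod_lt (z c) c.pos
      lia
    refine ⟨mem_rooms.2 ⟨fun c => ?_, fun a b => ?_⟩, fun l hl => ?_, by simp⟩
    · refine Fin.lastCases ?_ (fun c => ?_) c
      · simp; lia
      · simp only [Fin.snoc_castSucc]
        have h1 := hz'.1 c
        rw [mul_comm, ← Nat.div_lt_iff_lt_mul c.pos] at h1
        have := hr c
        nlinarith
    · refine Fin.lastCases ?_ (fun a => ?_) a <;> refine Fin.lastCases ?_ (fun b => ?_) b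
      · simp
      · simp only [Fin.snoc_castSucc, Fin.snoc_last, (hup _ _ (hr _)).2]
        intro h; simp at h
      · simp only [Fin.snoc_castSucc, Fin.snoc_last, (hup _ _ (hr _)).2]
        intro h; simp at h
      · simp only [Fin.snoc_castSucc, (hup _ _ (hr _)).2]
        intro h
        rw [hz'.2 (a₁ := a) (a₂ := b) (by simp only; lia)]
    · obtain ⟨i', h1, h3⟩ := hf l (by lia)
      refine ⟨i', by lia, by lia, ?_⟩
      rw [← hvert _ (by simp) (fun c => by
        simp only [Fin.snoc_castSucc, (hup _ _ (hr _)).2]; lia) i' h1, hinv]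
      exact h3
  · intro z hz
    simp only [coe_filter, Set.mem_ofPred_eq] at hz
    obtain ⟨hz, hd, h0⟩ := hz
    have hn := hne z hz h0
    ext c
    refine Fin.lastCases ?_ (fun c => ?_) c
    · simp [h0]
    · have := Nat.mod_lt (z c.castSucc) k.succ_pos
      have := hn c
      simp only [Fin.snoc_castSucc]
      rw [(hlow _ _ (by lia)).1, (hlow _ _ (by lia)).2, Nat.sub_add_cancel (by lia),
        Nat.div_add_mod]
  · intro z _
    exact hinv z

open Classical in
/-- Sperner's lemma for the cube: the number of rooms carrying all labels is odd. -/
theorem odd_full_rooms (N : ℕ) (hN : 0 < N) (k : ℕ) (lab : (Fin k → ℕ) → ℕ)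
    (hlab : Admissible N lab) : ((#{z ∈ rooms k N | IsFull lab z} : ℕ) : ZMod 2) = 1 := by
  induction k with
  | zero =>
    have : {z ∈ rooms 0 N | IsFull lab z} = {Fin.elim0} := by
      ext z
      simp only [mem_filter, mem_rooms, mem_singleton]
      refine ⟨fun _ => Subsingleton.elim _ _, fun _ => ⟨⟨fun c => c.elim0, fun c => c.elim0⟩, ?_⟩⟩
      intro l hl
      refine ⟨0, le_rfl, ?_⟩
      have := (hlab (vertex z 0) (fun c => c.elim0)).1
      lia
    rw [this]; simp
  | succ k ih =>
    have hlab' : Admissible N (fun v : Fin k → ℕ => lab (Fin.snoc v 0)) := by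
      intro v hv
      have h := hlab (Fin.snoc v 0) (by
        intro c
        refine Fin.lastCases ?_ (fun c => ?_) c
        · simp
        · simpa using hv c)
      refine ⟨?_, fun c => ?_⟩
      · have h1 := h.1
        have h2 := (h.2 (Fin.last k)).1 (by simp)
        simp at h2
        simp only
        lia
      · simpa using h.2 c.castSucc
    have hrec := ih _ hlab'
    have hsum : ((#{z ∈ rooms (k + 1) N | IsFull lab z} : ℕ) : ZMod 2) =
        ∑ i ∈ range (k + 2), ((#{z ∈ rooms (k + 1) N | IsDoor lab z i} : ℕ) : ZMod 2) := by
      have h1 : ∀ z ∈ rooms (k + 1) N, (if IsFull lab z then (1 : ZMod 2) else 0) =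
          ∑ i ∈ range (k + 2), if IsDoor lab z i then (1 : ZMod 2) else 0 := by
        intro z hz
        have := card_doors_of_room (k + 1) (fun i => lab (vertex z i))
          (fun i hi => (hlab _ (vertex_le hz hi)).1)
        rw [card_filter] at this
        push_cast at this
        convert this.symm using 1
        · exact if_congr Iff.rfl rfl rfl
        · exact sum_congr rfl fun _ _ => if_congr Iff.rfl rfl rfl
      simp only [card_filter]
      push_cast
      rw [sum_congr rfl h1, sum_comm]
    have hbot : #{z ∈ rooms (k + 1) N | IsDoor lab z (k + 1)} =
        #{z ∈ rooms (k + 1) N | IsDoor lab z (k + 1) ∧ ∀ c, 0 < z c} +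
        #{z ∈ rooms (k + 1) N | IsDoor lab z (k + 1) ∧ z (Fin.last k) = 0} := by
      rw [← card_filter_add_card_filter_not (s := {z ∈ rooms (k + 1) N | IsDoor lab z (k + 1)})
        (fun z => ∀ c, 0 < z c), filter_filter, filter_filter]
      congr 2
      apply filter_congr
      intro z hz
      refine and_congr_right fun hd => ⟨fun h => ?_, fun h h' => ?_⟩
      · push Not at h
        obtain ⟨c, hc⟩ := h
        have hc0 : z c = 0 := by lia
        have := eq_last_of_door_bottom hlab hz hd hc0
        have : c = Fin.last k := by ext; simp; lia
        rwa [← this]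
      · have := h' (Fin.last k); lia
    have htop : #{z ∈ rooms (k + 1) N | IsDoor lab z 0} =
        #{z ∈ rooms (k + 1) N | IsDoor lab z 0 ∧ ∀ c, z c + 1 < (k + 1) * N} := by
      congr 1
      apply filter_congr
      intro z hz
      exact ⟨fun h => ⟨h, no_door_top hlab hz h⟩, fun h => h.1⟩
    rw [hsum, sum_range_succ, sum_range_succ', sum_eq_zero, hbot, htop,
      card_door_shift k.succ_pos, card_bottom_doors hN]
    · push_cast
      rw [hrec, zero_add, ← add_assoc, CharTwo.add_self_eq_zero, zero_add]
    · intro i hi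
      exact even_inner_doors lab i.succ_pos (by simpa using hi)

end Sperner

/-! ### A covering theorem of Knaster–Kuratowski–Mazurkiewicz type -/

namespace Sperner

open Finset Filter Topology

/-- Each grid cube of mesh `1 / N` contains a simplex whose vertices lie in the `d + 1` sets. -/
lemma exists_close_points {d : ℕ} {A : ℕ → Set (Fin d → ℝ)}
    (hcover : ∀ v ∈ Set.Icc (0 : Fin d → ℝ) 1, ∃ i ≤ d, v ∈ A i ∧
      ∀ c : Fin d, (v c = 0 → i ≠ c + 1) ∧ (v c = 1 → i ≠ c)) {N : ℕ} (hN : 0 < N) :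
    ∃ b ∈ Set.Icc (0 : Fin d → ℝ) 1, ∀ i ≤ d, ∃ a ∈ A i, ∀ c, |a c - b c| ≤ 1 / (N : ℝ) := by
  classical
  have hN' : (0 : ℝ) < N := by exact_mod_cast hN
  have hmem : ∀ v : Fin d → ℕ, (∀ c, v c ≤ N) →
      (fun c => (v c : ℝ) / N) ∈ Set.Icc (0 : Fin d → ℝ) 1 := by
    intro v hv
    refine ⟨fun c => by simp only [Pi.zero_apply]; positivity, fun c => ?_⟩
    simp only [Pi.one_apply]
    rw [div_le_one hN']
    exact_mod_cast hv c
  have hlab : ∀ v : Fin d → ℕ, ∃ i : ℕ, (∀ c, v c ≤ N) → i ≤ d ∧ (fun c => (v c : ℝ) / N) ∈ A i ∧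
      ∀ c : Fin d, (v c = 0 → i ≠ c + 1) ∧ (v c = N → i ≠ c) := by
    intro v
    by_cases hv : ∀ c, v c ≤ N
    · obtain ⟨i, h1, h2, h3⟩ := hcover _ (hmem v hv)
      refine ⟨i, fun _ => ⟨h1, h2, fun c => ⟨fun h => (h3 c).1 ?_, fun h => (h3 c).2 ?_⟩⟩⟩
      · simp [h]
      · simp only [h]; exact div_self hN'.ne'
    · exact ⟨0, fun h => absurd h hv⟩
  choose lab hlab using hlab
  have hodd := odd_full_rooms N hN d lab (fun v hv => ⟨(hlab v hv).1, (hlab v hv).2.2⟩)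
  obtain ⟨z, hz⟩ : ({z ∈ rooms d N | IsFull lab z}).Nonempty := by
    rw [nonempty_iff_ne_empty]
    intro h
    rw [h] at hodd
    simp at hodd
  obtain ⟨hz, hfull⟩ := mem_filter.1 hz
  refine ⟨fun c => (vertex z 0 c : ℝ) / N, hmem _ (vertex_le hz (Nat.zero_le _)), fun l hl => ?_⟩
  obtain ⟨i, hi, rfl⟩ := hfull l hl
  refine ⟨_, (hlab _ (vertex_le hz hi)).2.1, fun c => ?_⟩
  have h1 : vertex z 0 c ≤ vertex z i c := Nat.div_le_div_right (by lia)
  have h2 : vertex z i c ≤ vertex z 0 c + 1 := by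
    have hd : 0 < d := c.pos
    unfold vertex
    rw [add_zero, ← Nat.add_div_right _ hd]
    exact Nat.div_le_div_right (by lia)
  have h1' : (vertex z 0 c : ℝ) ≤ vertex z i c := by exact_mod_cast h1
  have h2' : (vertex z i c : ℝ) ≤ vertex z 0 c + 1 := by exact_mod_cast h2
  rw [← sub_div, abs_of_nonneg (div_nonneg (by linarith) hN'.le)]
  gcongr
  linarith

/-- If closed sets `A 0, …, A d` cover the cube `[0, 1]^d` in such a way that points with
`v c = 0` are covered without the help of `A (c + 1)`, and points with `v c = 1` without the help
of `A c`, then the sets have a common point. -/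
theorem exists_mem_all_of_cover {d : ℕ} {A : ℕ → Set (Fin d → ℝ)}
    (hclosed : ∀ i ≤ d, IsClosed (A i))
    (hcover : ∀ v ∈ Set.Icc (0 : Fin d → ℝ) 1, ∃ i ≤ d, v ∈ A i ∧
      ∀ c : Fin d, (v c = 0 → i ≠ c + 1) ∧ (v c = 1 → i ≠ c)) :
    ∃ v ∈ Set.Icc (0 : Fin d → ℝ) 1, ∀ i ≤ d, v ∈ A i := by
  choose b hb a ha hab using fun s : ℕ => exists_close_points hcover (Nat.succ_pos s)
  obtain ⟨v, hv, φ, hφ, hlim⟩ := (isCompact_Icc (a := (0 : Fin d → ℝ)) (b := 1)).tendsto_subseq hb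
  refine ⟨v, hv, fun i hi => ?_⟩
  have hcoord : Tendsto (fun s => a (φ s) i hi) atTop (𝓝 v) := by
    rw [tendsto_pi_nhds] at hlim ⊢
    intro c
    have h0 : Tendsto (fun s => a (φ s) i hi c - b (φ s) c) atTop (𝓝 0) := by
      apply squeeze_zero_norm (a := fun s => 1 / ((φ s : ℝ) + 1))
      · intro s
        have := hab (φ s) i hi c
        simpa using this
      · exact tendsto_one_div_add_atTop_nhds_zero_nat.comp hφ.tendsto_atTop
    have := h0.add (hlim c)
    simpa using this
  exact (hclosed i hi).mem_of_tendsto hcoord (Eventually.of_forall fun s => ha (φ s) i hi)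

end Sperner

/-! ### Supporting weights under which every agent can be a least spender -/

namespace ChoreDivision

open Finset

/-- Costs are given by their logarithms `ℓ i j`, weights of the agents by their logarithms `u i`.
Agent `i` is tied for chore `j` if her weighted cost for it is the least one. -/
def Tied {I J : Type*} (ℓ : I → J → ℝ) (u : I → ℝ) (i : I) (j : J) : Prop :=
  ∀ k, u i + ℓ i j ≤ u k + ℓ k j

/-- The weighted cost of the bundle of agent `i` in the allocation `x`, for costs and weights given
by their logarithms. -/
noncomputable def load {I J : Type*} [Fintype J] [DecidableEq I] (ℓ : I → J → ℝ) (u : I → ℝ)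
    (x : J → I) (i : I) : ℝ :=
  ∑ j with x j = i, Real.exp (u i + ℓ i j)

lemma load_nonneg {I J : Type*} [Fintype J] [DecidableEq I] (ℓ : I → J → ℝ) (u : I → ℝ)
    (x : J → I) (i : I) : 0 ≤ load ℓ u x i :=
  sum_nonneg fun _ _ => (Real.exp_pos _).le

/-- The weights belonging to a point of the cube: the coordinate `v c` determines the ratio of the
weights of the agents `c` and `c + 1`. -/
noncomputable def weightOf {d : ℕ} (M : ℝ) (v : Fin d → ℝ) (i : Fin (d + 1)) : ℝ :=
  ∑ c : Fin d, if (c : ℕ) < i then M * (2 * v c - 1) else 0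

lemma weightOf_succ {d : ℕ} (M : ℝ) (v : Fin d → ℝ) (c : Fin d) :
    weightOf M v c.succ = weightOf M v c.castSucc + M * (2 * v c - 1) := by
  have h : ∀ e : Fin d, (if (e : ℕ) < (c.succ : ℕ) then M * (2 * v e - 1) else 0) =
      (if (e : ℕ) < (c.castSucc : ℕ) then M * (2 * v e - 1) else 0) +
        if e = c then M * (2 * v e - 1) else 0 := by
    intro e
    simp only [Fin.val_succ, Fin.val_castSucc, Fin.ext_iff]
    split_ifs <;> first | lia | simp
  simp only [weightOf, h, sum_add_distrib]
  simp

lemma abs_weightOf_le {d : ℕ} {M : ℝ} (hM : 0 ≤ M) {v : Fin d → ℝ}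
    (hv : v ∈ Set.Icc (0 : Fin d → ℝ) 1) (i : Fin (d + 1)) : |weightOf M v i| ≤ d * M := by
  calc |weightOf M v i| ≤ ∑ c : Fin d, |if (c : ℕ) < i then M * (2 * v c - 1) else 0| :=
        abs_sum_le_sum_abs _ _
    _ ≤ ∑ c : Fin d, M := by
        gcongr with c
        have h0 := hv.1 c
        have h1 := hv.2 c
        simp only [Pi.zero_apply, Pi.one_apply] at h0 h1
        split_ifs
        · rw [abs_le]; constructor <;> nlinarith
        · simpa using hM
    _ = d * M := by simp

lemma continuous_weightOf {d : ℕ} (M : ℝ) (i : Fin (d + 1)) :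
    Continuous fun v : Fin d → ℝ => weightOf M v i := by
  unfold weightOf
  refine continuous_finsetSum _ fun c _ => ?_
  split_ifs <;> fun_prop

/-- Walking down along the coordinates `0` and up along the coordinates `1` leads to a label that
is not excluded on any face. -/
lemma exists_allowed_label {d : ℕ} {v : Fin d → ℝ} {P : ℕ → Prop} {i₀ : ℕ} (h₀ : i₀ ≤ d)
    (hP : P i₀) (hdown : ∀ c : Fin d, v c = 0 → P c) (hup : ∀ c : Fin d, v c = 1 → P (c + 1)) :
    ∃ i ≤ d, P i ∧ ∀ c : Fin d, (v c = 0 → i ≠ c + 1) ∧ (v c = 1 → i ≠ c) := by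
  have down : ∀ i ≤ d, P i → (∀ c : Fin d, v c = 1 → i ≠ c) →
      ∃ i ≤ d, P i ∧ ∀ c : Fin d, (v c = 0 → i ≠ c + 1) ∧ (v c = 1 → i ≠ c) := by
    intro i
    induction i with
    | zero => exact fun h1 h2 h3 => ⟨0, h1, h2, fun c => ⟨fun _ => by lia, h3 c⟩⟩
    | succ i ih =>
      intro h1 h2 h3
      by_cases h : v ⟨i, h1⟩ = 0
      · refine ih (by lia) (hdown _ h) fun c hc heq => ?_
        have : c = ⟨i, h1⟩ := by ext; exact heq.symm
        rw [this, h] at hc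
        exact zero_ne_one hc
      · refine ⟨i + 1, h1, h2, fun c => ⟨fun hc heq => h ?_, h3 c⟩⟩
        have : c = ⟨i, h1⟩ := by ext; simp only; lia
        rwa [← this]
  have up : ∀ a i, i + a = d → P i →
      ∃ i ≤ d, P i ∧ ∀ c : Fin d, (v c = 0 → i ≠ c + 1) ∧ (v c = 1 → i ≠ c) := by
    intro a
    induction a with
    | zero => exact fun i hi h => down i (by lia) h fun c _ => by have := c.2; lia
    | succ a ih =>
      intro i hi h
      by_cases hv : v ⟨i, by lia⟩ = 1
      · exact ih (i + 1) (by lia) (hup _ hv)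
      · refine down i (by lia) h fun c hc heq => hv ?_
        have : c = ⟨i, by lia⟩ := by ext; exact heq.symm
        rwa [← this]
  exact up (d - i₀) i₀ (by lia) hP

/-- There are weights for which every agent is a least spender in some allocation supported by
these weights. -/
theorem exists_weights_all_least {d : ℕ} {J : Type*} [Fintype J] (ℓ : Fin (d + 1) → J → ℝ) (M : ℝ)
    (hM0 : 0 ≤ M) (hM : ∀ i k j, ℓ i j - ℓ k j < M) :
    ∃ u : Fin (d + 1) → ℝ, (∀ i, |u i| ≤ d * M) ∧
      ∀ i, ∃ x : J → Fin (d + 1), (∀ j, Tied ℓ u (x j) j) ∧ ∀ k, load ℓ u x i ≤ load ℓ u x k := by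
  let A : ℕ → Set (Fin d → ℝ) := fun i => {v | ∃ i' : Fin (d + 1), (i' : ℕ) = i ∧
    ∃ x : J → Fin (d + 1), (∀ j, Tied ℓ (weightOf M v) (x j) j) ∧
      ∀ k, load ℓ (weightOf M v) x i' ≤ load ℓ (weightOf M v) x k}
  have hclosed : ∀ i ≤ d, IsClosed (A i) := by
    intro i hi
    have : A i = ⋃ i' : {i' : Fin (d + 1) // (i' : ℕ) = i}, ⋃ x : J → Fin (d + 1),
        {v | (∀ j, Tied ℓ (weightOf M v) (x j) j) ∧
          ∀ k, load ℓ (weightOf M v) x i' ≤ load ℓ (weightOf M v) x k} := by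
      ext v
      simp [A]
    rw [this]
    refine isClosed_iUnion_of_finite fun i' => isClosed_iUnion_of_finite fun x => ?_
    have hc := continuous_weightOf (d := d) M
    have hl : ∀ k, Continuous fun v : Fin d → ℝ => load ℓ (weightOf M v) x k := by
      intro k
      unfold load
      have := hc k
      fun_prop
    simp only [Tied, Set.ofPred_and, Set.ofPred_forall]
    refine IsClosed.inter (isClosed_iInter fun j => isClosed_iInter fun k => ?_)
      (isClosed_iInter fun k => isClosed_le (hl _) (hl _))
    exact isClosed_le ((hc _).add continuous_const) ((hc _).add continuous_const)
  have hcover : ∀ v ∈ Set.Icc (0 : Fin d → ℝ) 1, ∃ i ≤ d, v ∈ A i ∧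
      ∀ c : Fin d, (v c = 0 → i ≠ c + 1) ∧ (v c = 1 → i ≠ c) := by
    intro v _
    have hx : ∀ j, ∃ i, Tied ℓ (weightOf M v) i j := fun j =>
      Finite.exists_min fun i => weightOf M v i + ℓ i j
    choose x hx using hx
    obtain ⟨i₀, hi₀⟩ := Finite.exists_min fun i => load ℓ (weightOf M v) x i
    have hzero : ∀ i, (∀ j, x j ≠ i) → ((i : ℕ) ∈ {i : ℕ | v ∈ A i}) := by
      intro i hi
      refine ⟨i, rfl, x, hx, fun k => ?_⟩
      have : load ℓ (weightOf M v) x i = 0 := by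
        unfold load
        rw [filter_false_of_mem fun j _ => hi j, sum_empty]
      rw [this]
      exact load_nonneg _ _ _ _
    refine exists_allowed_label (P := fun i => v ∈ A i) (i₀ := i₀) (by lia)
      ⟨i₀, rfl, x, hx, hi₀⟩ (fun c hc => ?_) (fun c hc => ?_)
    · refine hzero c.castSucc fun j hj => ?_
      have h1 := hx j c.succ
      rw [hj, weightOf_succ, hc] at h1
      have := hM c.succ c.castSucc j
      linarith
    · refine hzero c.succ fun j hj => ?_
      have h1 := hx j c.castSucc
      rw [hj, weightOf_succ, hc] at h1
      have := hM c.castSucc c.succ j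
      linarith
  obtain ⟨v, hv, h⟩ := Sperner.exists_mem_all_of_cover hclosed hcover
  refine ⟨weightOf M v, abs_weightOf_le hM0 hv, fun i => ?_⟩
  obtain ⟨i', h1, h2⟩ := h i (by lia)
  rwa [Fin.ext h1] at h2

/-! ### Rounding for generic costs -/

/-- If the logarithmic costs are linearly independent over `ℚ`, the graph of the ties is a forest,
so that Hall's condition holds and the chores with several tied agents can be matched to distinct
tied agents. -/
lemma exists_tied_injective {I J : Type*} [Fintype I] [Fintype J] [Nonempty I]
    {ℓ : I → J → ℝ} (hgen : LinearIndependent ℚ fun p : I × J => ℓ p.1 p.2) (u : I → ℝ) :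
    ∃ h : J → I, (∀ j, Tied ℓ u (h j) j) ∧ ∀ j j', (∃ i k, i ≠ k ∧ Tied ℓ u i j ∧ Tied ℓ u k j) →
      (∃ i k, i ≠ k ∧ Tied ℓ u i j' ∧ Tied ℓ u k j') → h j = h j' → j = j' := by
  classical
  let T := {j : J // ∃ i k, i ≠ k ∧ Tied ℓ u i j ∧ Tied ℓ u k j}
  let t : T → Finset I := fun j => {i | Tied ℓ u i j.1}
  have hhall : ∀ s : Finset T, #s ≤ #(s.biUnion t) := by
    intro s
    by_contra hcon
    push Not at hcon
    choose a b hab ha hb using fun j : T => j.2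
    have hmem : ∀ (j : s) (i : I), Tied ℓ u i j.1.1 → i ∈ s.biUnion t := fun j i hi =>
      mem_biUnion.2 ⟨j.1, j.2, by simpa [t] using hi⟩
    let w : s → (s.biUnion t → ℚ) := fun j =>
      Pi.single ⟨a j.1, hmem j _ (ha j.1)⟩ 1 - Pi.single ⟨b j.1, hmem j _ (hb j.1)⟩ 1
    have hdep : ¬ LinearIndependent ℚ w := by
      intro hli
      have := hli.fintype_card_le_finrank
      rw [Module.finrank_fintype_fun_eq_card, Fintype.card_coe, Fintype.card_coe] at this
      lia
    obtain ⟨g, hg, j₀, hj₀⟩ := Fintype.not_linearIndependent_iff.1 hdep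
    have hu := congrArg (Fintype.linearCombination ℚ (fun i : s.biUnion t => u i.1)) hg
    simp only [w, map_sum, map_smul, map_sub, Fintype.linearCombination_apply_single, one_smul,
      map_zero] at hu
    have hinj := linearIndependent_iff_injective_fintypeLinearCombination.1 hgen
    have hzero : Fintype.linearCombination ℚ (fun p : I × J => ℓ p.1 p.2)
        (∑ j : s, g j • (Pi.single (a j.1, j.1.1) 1 - Pi.single (b j.1, j.1.1) 1)) = 0 := by
      simp only [map_sum, map_smul, map_sub, Fintype.linearCombination_apply_single, one_smul]
      rw [← neg_eq_zero, ← hu, ← sum_neg_distrib]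
      refine sum_congr rfl fun j _ => ?_
      rw [← smul_neg]
      congr 1
      have h1 := ha j.1 (b j.1)
      have h2 := hb j.1 (a j.1)
      linarith
    have hμ := hinj (hzero.trans (map_zero _).symm)
    have := congrFun hμ (a j₀.1, j₀.1.1)
    rw [Finset.sum_apply, Finset.sum_eq_single j₀] at this
    · simp [hab j₀.1] at this
      exact hj₀ this
    · intro j _ hj
      have : j₀.1.1 ≠ j.1.1 := fun h => hj (Subtype.ext (Subtype.ext h.symm))
      simp [this]
    · simp
  obtain ⟨f, hf, hft⟩ := (Finset.all_card_le_biUnion_card_iff_exists_injective t).1 hhall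
  have hx : ∀ j, ∃ i, Tied ℓ u i j := fun j => Finite.exists_min fun i => u i + ℓ i j
  choose x hx using hx
  refine ⟨fun j => if hj : ∃ i k, i ≠ k ∧ Tied ℓ u i j ∧ Tied ℓ u k j then f ⟨j, hj⟩ else x j,
    fun j => ?_, fun j j' hj hj' h => ?_⟩
  · dsimp only
    split_ifs with hj
    · simpa [t] using hft ⟨j, hj⟩
    · exact hx j
  · simp only [dif_pos hj, dif_pos hj'] at h
    exact congrArg Subtype.val (hf h)

/-- An allocation supported by the weights `u` that is envy-free up to one chore with respect to
weighted costs. -/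
def IsWeightedEF1 {I J : Type*} [Fintype J] [DecidableEq I] (ℓ : I → J → ℝ) (u : I → ℝ)
    (x : J → I) : Prop :=
  (∀ j, Tied ℓ u (x j) j) ∧ ∀ i k, load ℓ u x i ≤ load ℓ u x k ∨
    ∃ j, x j = i ∧ load ℓ u x i - Real.exp (u i + ℓ i j) ≤ load ℓ u x k

lemma load_update_self {I J : Type*} [Fintype J] [DecidableEq I] [DecidableEq J] (ℓ : I → J → ℝ)
    (u : I → ℝ) (x : J → I) {j : J} {i : I} (hij : x j ≠ i) :
    load ℓ u (Function.update x j i) (x j) = load ℓ u x (x j) - Real.exp (u (x j) + ℓ (x j) j) := by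
  have : univ.filter (fun j' => x j' = x j) =
      insert j (univ.filter fun j' => Function.update x j i j' = x j) := by
    ext j'
    by_cases h : j' = j <;> simp [h]
  unfold load
  rw [this, sum_insert (by simpa using hij.symm)]
  ring

lemma load_le_load_update {I J : Type*} [Fintype J] [DecidableEq I] [DecidableEq J] (ℓ : I → J → ℝ)
    (u : I → ℝ) (x : J → I) {j : J} (i : I) {k : I} (hk : x j ≠ k) :
    load ℓ u x k ≤ load ℓ u (Function.update x j i) k := by
  unfold load
  refine sum_le_sum_of_subset_of_nonneg (fun j' hj' => ?_) fun _ _ _ => (Real.exp_pos _).le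
  simp only [mem_filter, mem_univ, true_and] at hj' ⊢
  rw [Function.update_of_ne]
  · exact hj'
  · rintro rfl; exact hk hj'

/-- Rounding.  Let `t` be the largest spending of a least spender among the given allocations; one
of them gives every agent a load of at least `t`.  Among all such supported allocations take one
that agrees with the matching `h` of shared chores to agents as often as possible.  An agent whose
load stays above `t` whichever chore is removed could pass on a shared chore `j` to `h j`; so she
holds at most the one shared chore that is matched to her, and without it her load is at most `t`,
since her unshared chores are with her in the allocation where she is a least spender. -/
theorem exists_isWeightedEF1_of_all_least {I J : Type*} [Fintype I] [Fintype J] [DecidableEq I]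
    [Nonempty I] {ℓ : I → J → ℝ} (hgen : LinearIndependent ℚ fun p : I × J => ℓ p.1 p.2) {u : I → ℝ}
    (hu : ∀ i, ∃ x : J → I, (∀ j, Tied ℓ u (x j) j) ∧ ∀ k, load ℓ u x i ≤ load ℓ u x k) :
    ∃ x, IsWeightedEF1 ℓ u x := by
  classical
  obtain ⟨h, hh, hinj⟩ := exists_tied_injective hgen u
  choose y hy hmin using hu
  obtain ⟨i₀, hi₀⟩ := Finite.exists_max fun i => load ℓ u (y i) i
  set t := load ℓ u (y i₀) i₀ with ht
  let S : Finset (J → I) := {x | (∀ j, Tied ℓ u (x j) j) ∧ ∀ k, t ≤ load ℓ u x k}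
  obtain ⟨x, hxS, hxmax⟩ := exists_max_image S (fun x => #{j | x j = h j})
    ⟨y i₀, by simp only [S, mem_filter, mem_univ, true_and]; exact ⟨hy i₀, hmin i₀⟩⟩
  simp only [S, mem_filter, mem_univ, true_and] at hxS
  obtain ⟨hxT, hxt⟩ := hxS
  refine ⟨x, hxT, fun b k => ?_⟩
  by_contra hcon
  push Not at hcon
  obtain ⟨hb, hbj⟩ := hcon
  have hb' : t < load ℓ u x b := (hxt k).trans_lt hb
  have hbj' : ∀ j, x j = b → t < load ℓ u x b - Real.exp (u b + ℓ b j) :=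
    fun j hj => (hxt k).trans_lt (hbj j hj)
  have hshared : ∀ j, x j = b → h j ≠ b → False := by
    rintro j rfl hj
    have hmem : Function.update x j (h j) ∈ S := by
      simp only [S, mem_filter, mem_univ, true_and]
      refine ⟨fun j' => ?_, fun k' => ?_⟩
      · by_cases hj' : j' = j
        · subst hj'; simpa using hh j'
        · simpa [hj'] using hxT j'
      · by_cases hk' : x j = k'
        · subst hk'
          rw [load_update_self ℓ u x hj.symm]
          exact (hbj' j rfl).le
        · exact (hxt k').trans (load_le_load_update ℓ u x _ hk')
    have hlt : #{j' | x j' = h j'} < #{j' | Function.update x j (h j) j' = h j'} := by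
      apply card_lt_card
      rw [ssubset_iff_of_subset]
      · exact ⟨j, by simp, by simpa using hj.symm⟩
      · intro j' hj'
        by_cases h' : j' = j
        · subst h'; simp
        · simpa [h'] using hj'
    exact absurd (hxmax _ hmem) (by lia)
  have hfix : ∀ s : Finset J, (∀ j ∈ s, x j = b ∧ ¬ ∃ i k, i ≠ k ∧ Tied ℓ u i j ∧ Tied ℓ u k j) →
      ∑ j ∈ s, Real.exp (u b + ℓ b j) ≤ t := by
    intro s hs
    refine le_trans ?_ (hi₀ b)
    unfold load
    refine sum_le_sum_of_subset_of_nonneg (fun j hj => ?_) fun _ _ _ => (Real.exp_pos _).le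
    obtain ⟨h1, h2⟩ := hs j hj
    simp only [mem_filter, mem_univ, true_and]
    by_contra hne
    exact h2 ⟨y b j, b, hne, hy b j, h1 ▸ hxT j⟩
  by_cases hex : ∃ j, x j = b ∧ ∃ i k, i ≠ k ∧ Tied ℓ u i j ∧ Tied ℓ u k j
  · obtain ⟨j, hj, hm⟩ := hex
    have hsub := hfix (({j' | x j' = b} : Finset J).erase j) (fun j' hj' => by
      simp only [mem_erase, mem_filter, mem_univ, true_and] at hj'
      refine ⟨hj'.2, fun hm' => hj'.1 ?_⟩
      refine hinj _ _ hm' hm ?_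
      rw [not_ne_iff.1 fun hne => hshared j' hj'.2 hne, not_ne_iff.1 fun hne => hshared j hj hne])
    have := hbj' j hj
    have hsum := add_sum_erase ({j' | x j' = b} : Finset J) (fun j => Real.exp (u b + ℓ b j))
      (show j ∈ ({j' | x j' = b} : Finset J) by simpa using hj)
    unfold load at this
    linarith
  · push Not at hex
    refine absurd (hfix ({j | x j = b} : Finset J) fun j hj => ?_) (not_le.2 hb')
    simp only [mem_filter, mem_univ, true_and] at hj
    refine ⟨hj, ?_⟩
    push Not
    exact hex j hj

end ChoreDivision

/-! ### Passing from generic costs to arbitrary costs -/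

namespace ChoreDivision

open Finset Filter Topology

/-- Vectors with coordinates linearly independent over `ℚ` are dense. -/
lemma exists_linearIndependent_near {ι : Type*} [Fintype ι] (f : ι → ℝ) {δ : ℝ} (hδ : 0 < δ) :
    ∃ g : ι → ℝ, LinearIndependent ℚ g ∧ ∀ i, |g i - f i| < δ := by
  have hd : Dense (⋂ a : {a : ι → ℚ // a ≠ 0}, {g : ι → ℝ | ∑ i, (a.1 i : ℝ) * g i ≠ 0}) := by
    apply dense_iInter_of_isOpen
    · intro a
      refine isOpen_ne_fun ?_ continuous_const
      fun_prop
    · rintro ⟨a, ha⟩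
      let K : Submodule ℝ (ι → ℝ) := (Fintype.linearCombination ℝ (fun i => (a i : ℝ))).ker
      have hK : {g : ι → ℝ | ∑ i, (a i : ℝ) * g i ≠ 0} = (K : Set (ι → ℝ))ᶜ := by
        ext g
        simp [K, Fintype.linearCombination_apply, mul_comm]
      change Dense {g : ι → ℝ | ∑ i, (a i : ℝ) * g i ≠ 0}
      rw [hK, ← interior_eq_empty_iff_dense_compl, ← Set.not_nonempty_iff_eq_empty]
      intro hne
      have htop := K.eq_top_of_nonempty_interior' hne
      apply ha
      ext i
      classical
      have : (Pi.single i (1 : ℝ) : ι → ℝ) ∈ K := htop ▸ Submodule.mem_top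
      simpa [K, Fintype.linearCombination_apply_single] using this
  obtain ⟨g, hg, hgf⟩ := hd.exists_dist_lt f hδ
  refine ⟨g, ?_, fun i => ?_⟩
  · rw [Fintype.linearIndependent_iff]
    intro a ha
    by_contra hcon
    push Not at hcon
    obtain ⟨i, hi⟩ := hcon
    have := Set.mem_iInter.1 hg ⟨a, fun h => hi (congrFun h i)⟩
    simp only [Set.mem_ofPred_eq] at this
    apply this
    simpa [Rat.smul_def] using ha
  · rw [dist_comm] at hgf
    exact (Real.dist_eq _ _ ▸ dist_le_pi_dist g f i).trans_lt hgf

/-- The limit of supported weighted EF1 allocations under perturbations `ε * i * r j` of the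
logarithmic costs that break all pairwise ties.  Ties between two agents end up broken by the
rank `r` of the chores. -/
theorem exists_isWeightedEF1 {d : ℕ} {J : Type*} [Fintype J] (L : Fin (d + 1) → J → ℝ)
    (r : J → ℕ) : ∃ (u : Fin (d + 1) → ℝ) (x : J → Fin (d + 1)), IsWeightedEF1 L u x ∧
      ∀ j j', x j < x j' → L (x j) j + L (x j') j' = L (x j') j + L (x j) j' → r j' ≤ r j := by
  classical
  let ε : ℕ → ℝ := fun k => 1 / ((k : ℝ) + 1)
  have hε : ∀ k, 0 < ε k := fun k => by positivity
  have hε1 : ∀ k, ε k ≤ 1 := fun k => by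
    simp only [ε]
    rw [div_le_one (by positivity)]
    have : (0 : ℝ) ≤ k := k.cast_nonneg
    linarith
  have hε0 : Tendsto ε atTop (𝓝 0) := tendsto_one_div_add_atTop_nhds_zero_nat
  choose g hg hgL using fun k => exists_linearIndependent_near
    (fun p : Fin (d + 1) × J => L p.1 p.2 + ε k * ((p.1 : ℕ) * (r p.2 : ℝ)))
    (show 0 < ε k / 8 by have := hε k; positivity)
  let B : ℝ := ∑ p : Fin (d + 1) × J, (|L p.1 p.2| + (p.1 : ℕ) * (r p.2 : ℝ)) + 1
  have hB : ∀ k p, |g k p| < B := by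
    intro k p
    have h1 : |L p.1 p.2| + (p.1 : ℕ) * (r p.2 : ℝ) + 1 ≤ B := by
      have := single_le_sum (s := univ)
        (f := fun p : Fin (d + 1) × J => |L p.1 p.2| + (p.1 : ℕ) * (r p.2 : ℝ))
        (fun _ _ => by positivity) (mem_univ p)
      simp only [B]
      linarith
    have h2 := hgL k p
    have h3 := hε k
    have h4 := hε1 k
    have h5 : ε k * ((p.1 : ℕ) * (r p.2 : ℝ)) ≤ (p.1 : ℕ) * (r p.2 : ℝ) :=
      mul_le_of_le_one_left (by positivity) h4
    have h6 : 0 ≤ ε k * ((p.1 : ℕ) * (r p.2 : ℝ)) := by positivity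
    rw [abs_lt] at h2 ⊢
    have h7 := neg_abs_le (L p.1 p.2)
    have h8 := le_abs_self (L p.1 p.2)
    constructor <;> linarith
  have hB0 : 0 ≤ B := by
    simp only [B]
    positivity
  have hex : ∀ k, ∃ (u : Fin (d + 1) → ℝ) (x : J → Fin (d + 1)), (∀ i, |u i| ≤ d * (2 * B)) ∧
      IsWeightedEF1 (fun i j => g k (i, j)) u x := by
    intro k
    obtain ⟨u, hu, hall⟩ := exists_weights_all_least (fun i j => g k (i, j)) (2 * B) (by linarith)
      (fun i i' j => by
        have h1 := (abs_lt.1 (hB k (i, j))).2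
        have h2 := (abs_lt.1 (hB k (i', j))).1
        linarith)
    obtain ⟨x, hx⟩ := exists_isWeightedEF1_of_all_least (hg k) hall
    exact ⟨u, x, hu, hx⟩
  choose u x hu hx using hex
  let F : Ultrafilter ℕ := hyperfilter ℕ
  have hF : (F : Filter ℕ) ≤ atTop := Nat.hyperfilter_le_atTop
  obtain ⟨u₀, -, hu₀⟩ := (isCompact_closedBall (0 : Fin (d + 1) → ℝ) (d * (2 * B))).ultrafilter_le_nhds
    (F.map u) (by
      rw [Ultrafilter.coe_map, le_principal_iff]
      refine Filter.mem_map.2 (Eventually.of_forall fun k => mem_closedBall_zero_iff.2 ?_)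
      exact (pi_norm_le_iff_of_nonneg (by positivity)).2 (hu k))
  obtain ⟨x₀, hx₀⟩ := (F.map x).eq_pure_of_finite
  have hux : ∀ i, Tendsto (fun k => u k i) F (𝓝 (u₀ i)) := tendsto_pi_nhds.1 hu₀
  have hxx : ∀ᶠ k in F, x k = x₀ := by
    have : ({x₀} : Set (J → Fin (d + 1))) ∈ F.map x := by rw [hx₀]; exact rfl
    exact this
  have hgx : ∀ p, Tendsto (fun k => g k p) F (𝓝 (L p.1 p.2)) := by
    intro p
    have h1 : Tendsto (fun k => g k p - (L p.1 p.2 + ε k * ((p.1 : ℕ) * (r p.2 : ℝ)))) F (𝓝 0) := by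
      refine squeeze_zero_norm (a := fun k => ε k / 8) (fun k => (hgL k p).le) ?_
      simpa using (hε0.mono_left hF).div_const 8
    have h2 : Tendsto (fun k => L p.1 p.2 + ε k * ((p.1 : ℕ) * (r p.2 : ℝ))) F (𝓝 (L p.1 p.2)) := by
      simpa using ((hε0.mono_left hF).mul_const ((p.1 : ℕ) * (r p.2 : ℝ))).const_add (L p.1 p.2)
    simpa using h1.add h2
  have hexp : ∀ i j, Tendsto (fun k => Real.exp (u k i + g k (i, j))) F
      (𝓝 (Real.exp (u₀ i + L i j))) := fun i j =>
    (Real.continuous_exp.tendsto _).comp ((hux i).add (hgx (i, j)))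
  have hload : ∀ i, Tendsto (fun k => load (fun i j => g k (i, j)) (u k) x₀ i) F
      (𝓝 (load L u₀ x₀ i)) := fun i => tendsto_finsetSum _ fun j _ => hexp i j
  refine ⟨u₀, x₀, ⟨fun j i => ?_, fun i k => ?_⟩, fun j j' hlt heq => ?_⟩
  · refine le_of_tendsto_of_tendsto ((hux _).add (hgx (x₀ j, j))) ((hux i).add (hgx (i, j))) ?_
    filter_upwards [hxx] with k hk
    have := (hx k).1 j i
    rwa [hk] at this
  · by_contra hcon
    push Not at hcon
    obtain ⟨h1, h2⟩ := hcon
    have e1 := (hload k).eventually_lt (hload i) h1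
    have e2 : ∀ᶠ s in F, ∀ j, x₀ j = i → load (fun i j => g s (i, j)) (u s) x₀ k <
        load (fun i j => g s (i, j)) (u s) x₀ i - Real.exp (u s i + g s (i, j)) := by
      rw [eventually_all]
      intro j
      by_cases hj : x₀ j = i
      · filter_upwards [(hload k).eventually_lt ((hload i).sub (hexp i j)) (h2 j hj)] with s hs _
        exact hs
      · exact Eventually.of_forall fun s h => absurd h hj
    obtain ⟨s, hs1, hs2, hs3⟩ := (e1.and (e2.and hxx)).exists
    have := (hx s).2 i k
    rw [hs3] at this
    rcases this with h | ⟨j, hj, h⟩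
    · exact absurd hs1 (not_lt.2 h)
    · exact absurd (hs2 j hj) (not_lt.2 h)
  · by_contra hcon
    push Not at hcon
    obtain ⟨s, hs⟩ := hxx.exists
    have h1 := (hx s).1 j (x₀ j')
    have h2 := (hx s).1 j' (x₀ j)
    rw [hs] at h1 h2
    have a1 := (abs_lt.1 (hgL s (x₀ j, j))).1
    have a2 := (abs_lt.1 (hgL s (x₀ j', j'))).1
    have a3 := (abs_lt.1 (hgL s (x₀ j', j))).2
    have a4 := (abs_lt.1 (hgL s (x₀ j, j'))).2
    simp only at a1 a2 a3 a4
    have hi : ((x₀ j : ℕ) : ℝ) + 1 ≤ (x₀ j' : ℕ) := by exact_mod_cast hlt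
    have hr : (r j : ℝ) + 1 ≤ r j' := by exact_mod_cast hcon
    have hprod : (1 : ℝ) ≤ (((x₀ j' : ℕ) : ℝ) - (x₀ j : ℕ)) * (r j' - r j) := by
      nlinarith
    have := mul_le_mul_of_nonneg_left hprod (hε s).le
    have := hε s
    nlinarith

lemma sum_pos_chores {m : ℕ} {I : Type*} [DecidableEq I] (P : Fin m → Prop) [DecidablePred P]
    (y : {j // P j} → I) (x : Fin m → I) (hxy : ∀ j : {j // P j}, x j = y j) (i : I)
    (f : Fin m → ℕ) : ∑ j : {j // P j} with y j = i, f j = ∑ j with x j = i ∧ P j, f j := by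
  refine (sum_map _ (Function.Embedding.subtype P) f).symm.trans ?_
  congr 1
  ext j
  simp only [Finset.mem_map, mem_filter, mem_univ, true_and, Function.Embedding.coe_subtype]
  constructor
  · rintro ⟨j, h, rfl⟩
    exact ⟨(hxy j).trans h, j.2⟩
  · rintro ⟨h, hP⟩
    exact ⟨⟨j, hP⟩, (hxy ⟨j, hP⟩).symm.trans h, rfl⟩

/-- Existence of an EF1 allocation supported by positive weights.  Chores that cost nothing to some
agent go to the first such agent; ties between two agents on other chores are broken by the
index. -/
theorem exists_supported_ef1 {d m : ℕ} (c : Fin (d + 1) → Fin m → ℕ) :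
    ∃ (w : Fin (d + 1) → ℝ) (x : Fin m → Fin (d + 1)), (∀ i, 0 < w i) ∧
      (∀ j i, w (x j) * c (x j) j ≤ w i * c i j) ∧
      (∀ j, (∃ i, c i j = 0) → c (x j) j = 0 ∧ ∀ i < x j, c i j ≠ 0) ∧
      (∀ i i', cost c i (bundle x i) ≤ cost c i (bundle x i') ∨
        ∃ j, x j = i ∧ cost c i (bundle x i) ≤ cost c i (bundle x i') + c i j) ∧
      ∀ j j', (∀ i, c i j ≠ 0) → (∀ i, c i j' ≠ 0) → x j < x j' →
        c (x j) j * c (x j') j' = c (x j') j * c (x j) j' → j' ≤ j := by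
  classical
  obtain ⟨u, y, ⟨hT, hE⟩, htb⟩ := exists_isWeightedEF1 (J := {j : Fin m // ∀ i, c i j ≠ 0})
    (fun i j => Real.log (c i j)) (fun j => j.1)
  have hlog : ∀ i (j : {j : Fin m // ∀ i, c i j ≠ 0}), Real.exp (u i + Real.log (c i j)) =
      Real.exp (u i) * c i j := by
    intro i j
    rw [Real.exp_add, Real.exp_log]
    exact_mod_cast Nat.pos_of_ne_zero (j.2 i)
  have hx : ∀ j : Fin m, ∃ i, if h : ∀ i, c i j ≠ 0 then i = y ⟨j, h⟩
      else c i j = 0 ∧ ∀ i' < i, c i' j ≠ 0 := by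
    intro j
    split_ifs with h
    · exact ⟨_, rfl⟩
    · push Not at h
      have hne : (univ.filter fun i => c i j = 0).Nonempty := by
        obtain ⟨i, hi⟩ := h
        exact ⟨i, by simpa using hi⟩
      refine ⟨(univ.filter fun i => c i j = 0).min' hne, ?_, fun i' hi' h' => ?_⟩
      · simpa using Finset.min'_mem _ hne
      · exact absurd (Finset.min'_le _ i' (by simpa using h')) (not_le.2 hi')
  choose x hx using hx
  have hxpos : ∀ j (h : ∀ i, c i j ≠ 0), x j = y ⟨j, h⟩ := by
    intro j h
    have := hx j
    rwa [dif_pos h] at this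
  have hxzero : ∀ j, (∃ i, c i j = 0) → c (x j) j = 0 ∧ ∀ i < x j, c i j ≠ 0 := by
    intro j h
    have := hx j
    rwa [dif_neg (by push Not; exact h)] at this
  have hown : ∀ i, cost c i (bundle x i) = ∑ j with x j = i ∧ ∀ i, c i j ≠ 0, c i j := by
    intro i
    unfold cost bundle
    rw [← filter_filter]
    refine (sum_filter_of_ne ?_).symm
    intro j hj hne k hk
    simp only [mem_filter, mem_univ, true_and] at hj
    exact hne (hj ▸ (hxzero j ⟨k, hk⟩).1)
  have hother : ∀ i k, ∑ j with x j = k ∧ ∀ i, c i j ≠ 0, c i j ≤ cost c i (bundle x k) := by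
    intro i k
    unfold cost bundle
    refine sum_le_sum_of_subset fun j hj => ?_
    simp only [mem_filter, mem_univ, true_and] at hj ⊢
    exact hj.1
  have hloadown : ∀ i, load (fun i (j : {j : Fin m // ∀ i, c i j ≠ 0}) => Real.log (c i j)) u y i =
      Real.exp (u i) * (cost c i (bundle x i) : ℕ) := by
    intro i
    rw [hown, ← sum_pos_chores _ y x (fun j => hxpos j.1 j.2), load]
    push_cast
    rw [mul_sum]
    exact sum_congr rfl fun j _ => hlog i j
  have hloadother : ∀ i k,
      load (fun i (j : {j : Fin m // ∀ i, c i j ≠ 0}) => Real.log (c i j)) u y k ≤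
      Real.exp (u i) * (cost c i (bundle x k) : ℕ) := by
    intro i k
    refine le_trans ?_ (mul_le_mul_of_nonneg_left (Nat.cast_le.2 (hother i k)) (Real.exp_pos _).le)
    rw [← sum_pos_chores _ y x (fun j => hxpos j.1 j.2), load]
    push_cast
    rw [mul_sum]
    refine sum_le_sum fun j hj => ?_
    simp only [mem_filter, mem_univ, true_and] at hj
    rw [← hlog i j]
    exact Real.exp_le_exp.2 (hj ▸ hT j i)
  refine ⟨fun i => Real.exp (u i), x, fun i => Real.exp_pos _, fun j i => ?_, hxzero,
    fun i k => ?_, fun j j' hj hj' hlt heq => ?_⟩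
  · by_cases h : ∀ i, c i j ≠ 0
    · have := Real.exp_le_exp.2 (hT ⟨j, h⟩ i)
      rw [hlog, hlog, ← hxpos] at this
      exact this
    · push Not at h
      rw [(hxzero j h).1]
      simp only [Nat.cast_zero, mul_zero]
      positivity
  · have hpos := Real.exp_pos (u i)
    rcases hE i k with h | ⟨j, hj, h⟩
    · left
      rw [hloadown] at h
      exact_mod_cast le_of_mul_le_mul_left (h.trans (hloadother i k)) hpos
    · right
      refine ⟨j, (hxpos j.1 j.2).trans hj, ?_⟩
      have h' := h.trans (hloadother i k)
      rw [hloadown, hlog] at h'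
      have : Real.exp (u i) * (cost c i (bundle x i) : ℕ) ≤
          Real.exp (u i) * ((cost c i (bundle x k) : ℕ) + c i j) := by linarith
      exact_mod_cast le_of_mul_le_mul_left this hpos
  · rw [hxpos j hj, hxpos j' hj'] at hlt heq
    refine htb ⟨j, hj⟩ ⟨j', hj'⟩ hlt ?_
    have hne : ∀ (j : Fin m), (∀ i, c i j ≠ 0) → ∀ i, (c i j : ℝ) ≠ 0 := fun j h i => by
      exact_mod_cast h i
    rw [← Real.log_mul (hne j hj _) (hne j' hj' _), ← Real.log_mul (hne j hj _) (hne j' hj' _)]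
    congr 1
    exact_mod_cast heq

end ChoreDivision

/-! ### Certifying Pareto optimality by shortest paths -/

namespace ChoreDivision

open Finset
open scoped ENNReal

/-- An allocation minimizing a positively weighted sum of the costs is Pareto optimal. -/
lemma isPO_of_weights {n m : ℕ} {c : Fin n → Fin m → ℕ} {x : Fin m → Fin n} {w : Fin n → ℝ}
    (hw : ∀ i, 0 < w i) (hx : ∀ j i, w (x j) * c (x j) j ≤ w i * c i j) : IsPO c x := by
  have key : ∀ y : Fin m → Fin n, ∑ i, w i * (cost c i (bundle y i) : ℕ) =
      ∑ j, w (y j) * c (y j) j := by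
    intro y
    rw [← sum_fiberwise univ y (fun j => w (y j) * c (y j) j)]
    refine sum_congr rfl fun i _ => ?_
    unfold cost bundle
    push_cast
    rw [mul_sum]
    refine sum_congr rfl fun j hj => ?_
    rw [(mem_filter.1 hj).2]
  rintro ⟨y, hle, i, hlt⟩
  have h1 : ∑ i, w i * (cost c i (bundle y i) : ℕ) < ∑ i, w i * (cost c i (bundle x i) : ℕ) := by
    refine sum_lt_sum (fun k _ => ?_) ⟨i, mem_univ _, ?_⟩
    · exact mul_le_mul_of_nonneg_left (by exact_mod_cast hle k) (hw k).le
    · exact mul_lt_mul_of_pos_left (by exact_mod_cast hlt) (hw i)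
  rw [key, key] at h1
  exact absurd (sum_le_sum fun j (_ : j ∈ univ) => hx j (y j)) (not_le.2 h1)

/-- The Floyd–Warshall recursion in multiplicative form: `shortest R k i i'` is the least product
of lengths `R` over the walks from `i` to `i'` with intermediate stops below `k`. -/
noncomputable def shortest (R : ℕ → ℕ → ℝ≥0∞) : ℕ → ℕ → ℕ → ℝ≥0∞
  | 0, i, i' => R i i'
  | k + 1, i, i' => min (shortest R k i i') (shortest R k i k * shortest R k k i')

lemma shortest_antitone (R : ℕ → ℕ → ℝ≥0∞) (i i' : ℕ) : Antitone fun k => shortest R k i i' :=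
  antitone_nat_of_succ_le fun _ => min_le_left _ _

lemma shortest_ne_zero {R : ℕ → ℕ → ℝ≥0∞} (hR : ∀ i i', R i i' ≠ 0) (k i i' : ℕ) :
    shortest R k i i' ≠ 0 := by
  induction k generalizing i i' with
  | zero => exact hR i i'
  | succ k ih =>
    rw [shortest]
    rcases min_choice (shortest R k i i') (shortest R k i k * shortest R k k i') with h | h <;>
      rw [h]
    · exact ih i i'
    · exact mul_ne_zero (ih i k) (ih k i')

/-- Without short cycles the computed lengths satisfy the triangle inequality. -/
lemma shortest_triangle {R : ℕ → ℕ → ℝ≥0∞} {n : ℕ} (hdiag : ∀ i < n, 1 ≤ shortest R n i i) {k : ℕ}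
    (hk : k ≤ n) {l : ℕ} (hl : l < k) (i i' : ℕ) :
    shortest R k i i' ≤ shortest R k i l * shortest R k l i' := by
  induction k generalizing l i i' with
  | zero => lia
  | succ k ih =>
    have hd : ∀ l < n, 1 ≤ shortest R k l l := fun l hl =>
      (hdiag l hl).trans (shortest_antitone R l l (by lia))
    have hkk := hd k (by lia)
    simp only [shortest]
    rcases (Nat.lt_succ_iff.1 hl).lt_or_eq with hlk | rfl
    · have h1 : ∀ a b : ℝ≥0∞, (shortest R k i k * shortest R k k l) * a * b =
          shortest R k i k * (shortest R k k l * a * b) := fun a b => by ring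
      rcases min_choice (shortest R k i l) (shortest R k i k * shortest R k k l) with h | h <;>
        rcases min_choice (shortest R k l i') (shortest R k l k * shortest R k k i') with h' | h' <;>
        rw [h, h']
      · exact (min_le_left _ _).trans (ih (by lia) hlk i i')
      · refine (min_le_right _ _).trans ?_
        rw [← mul_assoc]
        gcongr
        exact ih (by lia) hlk i k
      · refine (min_le_right _ _).trans ?_
        rw [mul_assoc]
        gcongr
        exact ih (by lia) hlk k i'
      · refine (min_le_right _ _).trans ?_
        have h2 : 1 ≤ shortest R k k l * shortest R k l k := hkk.trans (ih (by lia) hlk k k)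
        calc shortest R k i k * shortest R k k i'
            ≤ shortest R k i k * ((shortest R k k l * shortest R k l k) * shortest R k k i') := by
              gcongr
              exact le_mul_of_one_le_left' h2
          _ = _ := by ring
    · rw [min_eq_left (le_mul_of_one_le_right' hkk), min_eq_left (le_mul_of_one_le_left' hkk)]
      exact min_le_right _ _

/-- If no cycle is shorter than `1`, there are finite positive potentials for the lengths `R`. -/
lemma exists_potential {R : ℕ → ℕ → ℝ≥0∞} {n : ℕ} (hR : ∀ i i', R i i' ≠ 0)
    (hdiag : ∀ i < n, 1 ≤ shortest R n i i) :
    ∃ v : ℕ → ℝ≥0∞, (∀ i, v i ≠ 0 ∧ v i ≠ ∞) ∧ ∀ i < n, ∀ i', v i' ≤ v i * R i i' := by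
  have hle : ∀ k < n, ∀ i, min 1 ((range n).inf fun k => shortest R n k i) ≤ shortest R n k i :=
    fun k hk i => (min_le_right _ _).trans (inf_le (mem_range.2 hk))
  have hv : ∀ i, min 1 ((range n).inf fun k => shortest R n k i) = 1 ∨
      ∃ k < n, min 1 ((range n).inf fun k => shortest R n k i) = shortest R n k i := by
    intro i
    rcases min_choice 1 ((range n).inf fun k => shortest R n k i) with h | h
    · exact Or.inl h
    · rcases (range n).eq_empty_or_nonempty with hn | hn
      · left
        simp [hn]
      · obtain ⟨k, hk, hk'⟩ := exists_mem_eq_inf (range n) hn fun k => shortest R n k i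
        exact Or.inr ⟨k, by simpa using hk, h.trans hk'⟩
  refine ⟨fun i => min 1 ((range n).inf fun k => shortest R n k i), fun i => ⟨?_, ?_⟩,
    fun i hi i' => ?_⟩
  · rcases hv i with h | ⟨k, hk, h⟩ <;> simp only [h]
    · exact one_ne_zero
    · exact shortest_ne_zero hR n k i
  · exact ((min_le_left _ _).trans_lt ENNReal.one_lt_top).ne
  · rcases hv i with h | ⟨k, hk, h⟩ <;> simp only [h]
    · rw [one_mul]
      exact (hle i hi i').trans (shortest_antitone R i i' (Nat.zero_le n))
    · refine (hle k hk i').trans ((shortest_triangle hdiag le_rfl hi k i').trans ?_)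
      gcongr
      exact shortest_antitone R i i' (Nat.zero_le n)

/-- Potentials for `R` show that no cycle is shorter than `1`. -/
lemma one_le_shortest {R : ℕ → ℕ → ℝ≥0∞} {n : ℕ} {v : ℕ → ℝ≥0∞}
    (hv : ∀ i < n, v i ≠ 0 ∧ v i ≠ ∞) (hvR : ∀ i < n, ∀ i' < n, v i' ≤ v i * R i i') :
    ∀ i < n, 1 ≤ shortest R n i i := by
  have h : ∀ k ≤ n, ∀ i < n, ∀ i' < n, v i' ≤ v i * shortest R k i i' := by
    intro k
    induction k with
    | zero => exact fun _ => hvR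
    | succ k ih =>
      intro hk i hi i' hi'
      rw [shortest]
      rcases min_choice (shortest R k i i') (shortest R k i k * shortest R k k i') with h | h <;>
        rw [h]
      · exact ih (by lia) i hi i' hi'
      · calc v i' ≤ v k * shortest R k k i' := ih (by lia) k (by lia) i' hi'
          _ ≤ (v i * shortest R k i k) * shortest R k k i' := by
            gcongr
            exact ih (by lia) i hi k (by lia)
          _ = _ := mul_assoc _ _ _
  intro i hi
  have h1 := h n le_rfl i hi i hi
  exact (ENNReal.mul_le_mul_iff_right (hv i hi).1 (hv i hi).2).1 (by simpa using h1)

end ChoreDivision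

/-! ### Time bounds for the random-access machine -/

namespace RAM

/-- All cells of the memory hold numbers of bit length at most `B`. -/
def Bounded (B : ℕ) (s : State) : Prop := ∀ a k, (s a k).size ≤ B

lemma Bounded.mono {B B' : ℕ} (h : B ≤ B') {s : State} (hs : Bounded B s) : Bounded B' s :=
  fun a k => (hs a k).trans h

lemma size_add_le (a b : ℕ) : (a + b).size ≤ a.size + b.size + 1 := by
  rw [Nat.size_le, pow_succ, pow_add]
  have ha := Nat.lt_size_self a
  have hb := Nat.lt_size_self b
  nlinarith [Nat.one_le_two_pow (n := a.size), Nat.one_le_two_pow (n := b.size)]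

lemma size_mul_le (a b : ℕ) : (a * b).size ≤ a.size + b.size := by
  rw [Nat.size_le, pow_add]
  have ha := Nat.lt_size_self a
  have hb := Nat.lt_size_self b
  exact Nat.mul_lt_mul'' ha hb

/-- The bit length of the value of a fixed expression and the time for evaluating it are linear in
the largest bit length in memory. -/
lemma Exp.exists_bound (e : Exp) : ∃ K, ∀ B s, Bounded B s →
    (e.eval s).size ≤ K * (B + 1) ∧ e.time s ≤ K * (B + 1) := by
  induction e with
  | const k =>
    refine ⟨k.size + 1, fun B s _ => ?_⟩
    simp only [Exp.eval, Exp.time]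
    constructor <;> nlinarith
  | read a e ih =>
    obtain ⟨K, hK⟩ := ih
    refine ⟨2 * K + 1, fun B s hs => ?_⟩
    obtain ⟨h1, h2⟩ := hK B s hs
    have := hs a (e.eval s)
    simp only [Exp.eval, Exp.time]
    constructor <;> nlinarith
  | add e f ihe ihf | sub e f ihe ihf | mul e f ihe ihf | div e f ihe ihf =>
    obtain ⟨K, hK⟩ := ihe
    obtain ⟨K', hK'⟩ := ihf
    refine ⟨2 * K + 2 * K' + 1, fun B s hs => ?_⟩
    obtain ⟨h1, h2⟩ := hK B s hs
    obtain ⟨h3, h4⟩ := hK' B s hs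
    simp only [Exp.eval, Exp.time]
    have hadd := size_add_le (e.eval s) (f.eval s)
    have hsub := Nat.size_le_size (Nat.sub_le (e.eval s) (f.eval s))
    have hmul := size_mul_le (e.eval s) (f.eval s)
    have hdiv := Nat.size_le_size (Nat.div_le_self (e.eval s) (f.eval s))
    constructor <;> nlinarith

/-- Programs without loops. -/
def Program.LoopFree : Program → Prop
  | .skip => True
  | .write _ _ _ => True
  | .seq P Q => P.LoopFree ∧ Q.LoopFree
  | .ite _ P Q => P.LoopFree ∧ Q.LoopFree
  | .loop _ _ => False

/-- The final memory of a program without loops. -/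
def Program.run : Program → State → State
  | .skip, s => s
  | .write a e f, s => s.set a (e.eval s) (f.eval s)
  | .seq P Q, s => Q.run (P.run s)
  | .ite e P Q, s => if e.eval s ≠ 0 then P.run s else Q.run s
  | .loop _ _, s => s

lemma State.set_apply (s : State) (a k v b r : ℕ) :
    s.set a k v b r = if b = a ∧ r = k then v else s b r := by
  unfold State.set
  by_cases hb : b = a
  · subst hb
    by_cases hr : r = k
    · subst hr; simp
    · simp [hr]
  · simp [hb]

/-- A fixed program without loops takes time linear in the largest bit length in memory. -/
lemma Program.LoopFree.exists_exec {P : Program} (hP : P.LoopFree) : ∃ K, ∀ B s, Bounded B s →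
    Bounded (K * (B + 1)) (P.run s) ∧ ∃ T ≤ K * (B + 1), Exec P s (P.run s) T := by
  induction P with
  | skip =>
    refine ⟨1, fun B s hs => ⟨hs.mono (by lia), 1, by lia, Exec.skip s⟩⟩
  | write a e f =>
    obtain ⟨K, hK⟩ := e.exists_bound
    obtain ⟨K', hK'⟩ := f.exists_bound
    refine ⟨2 * K + 2 * K' + 1, fun B s hs => ⟨fun b r => ?_, _, ?_, Exec.write a e f s⟩⟩
    · obtain ⟨h3, h4⟩ := hK' B s hs
      have := hs b r
      simp only [Program.run, State.set_apply]
      split_ifs <;> nlinarith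
    · obtain ⟨h1, h2⟩ := hK B s hs
      obtain ⟨h3, h4⟩ := hK' B s hs
      nlinarith
  | seq P Q ihP ihQ =>
    obtain ⟨K, hK⟩ := ihP hP.1
    obtain ⟨K', hK'⟩ := ihQ hP.2
    refine ⟨K + K' * (K + 1), fun B s hs => ?_⟩
    obtain ⟨h1, T, hT, hE⟩ := hK B s hs
    obtain ⟨h2, T', hT', hE'⟩ := hK' _ _ h1
    have hle : K' * (K * (B + 1) + 1) ≤ K' * (K + 1) * (B + 1) := by
      rw [mul_assoc]
      gcongr
      nlinarith
    exact ⟨h2.mono (by nlinarith), T + T', by nlinarith, hE.seq hE'⟩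
  | ite e P Q ihP ihQ =>
    obtain ⟨Ke, he⟩ := e.exists_bound
    obtain ⟨K, hK⟩ := ihP hP.1
    obtain ⟨K', hK'⟩ := ihQ hP.2
    refine ⟨2 * Ke + 1 + K + K', fun B s hs => ?_⟩
    obtain ⟨h1, h2⟩ := he B s hs
    by_cases h : e.eval s = 0
    · obtain ⟨h3, T, hT, hE⟩ := hK' B s hs
      simp only [Program.run, h, ne_eq, not_true_eq_false, if_false]
      exact ⟨h3.mono (by nlinarith), _, by nlinarith, Exec.ite_false h hE⟩
    · obtain ⟨h3, T, hT, hE⟩ := hK B s hs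
      simp only [Program.run, h, ne_eq, not_false_eq_true, if_true]
      exact ⟨h3.mono (by nlinarith), _, by nlinarith, Exec.ite_true h hE⟩
  | loop e P _ => exact hP.elim

/-- The rule for a loop with loop-free body: `Inv` is an invariant, indexed by `ι`, that bounds the
memory, and `μ` decreases in every round. -/
theorem exists_exec_loop (e : Exp) {P : Program} (hP : P.LoopFree) : ∃ K, ∀ (B : ℕ) (ι : Type)
    (Inv : ι → State → Prop) (μ : ι → ℕ), (∀ i s, Inv i s → Bounded B s) →
    (∀ i s, Inv i s → e.eval s ≠ 0 → ∃ i', μ i' < μ i ∧ Inv i' (P.run s)) →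
    ∀ i s, Inv i s → ∃ i' t, Inv i' t ∧ e.eval t = 0 ∧
      ∃ T ≤ K * (B + 1) * (μ i + 1), Exec (.loop e P) s t T := by
  obtain ⟨Ke, he⟩ := e.exists_bound
  obtain ⟨K, hK⟩ := hP.exists_exec
  refine ⟨2 * Ke + 1 + K, fun B ι Inv μ hB hstep => ?_⟩
  have main : ∀ N i s, μ i = N → Inv i s → ∃ i' t, Inv i' t ∧ e.eval t = 0 ∧
      ∃ T ≤ (2 * Ke + 1 + K) * (B + 1) * (μ i + 1), Exec (.loop e P) s t T := by
    intro N
    induction N using Nat.strong_induction_on with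
    | _ N ih =>
      intro i s hN hi
      obtain ⟨h1, h2⟩ := he B s (hB i s hi)
      by_cases h : e.eval s = 0
      · refine ⟨i, s, hi, h, _, ?_, Exec.loop_false h⟩
        nlinarith [Nat.zero_le (μ i * ((2 * Ke + 1 + K) * (B + 1)))]
      · obtain ⟨i', hlt, hi'⟩ := hstep i s hi h
        obtain ⟨-, T, hT, hE⟩ := hK B s (hB i s hi)
        obtain ⟨i'', t, h3, h4, T', hT', hE'⟩ := ih _ (hN ▸ hlt) i' _ rfl hi'
        refine ⟨i'', t, h3, h4, _, ?_, Exec.loop_true h hE hE'⟩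
        have h5 : (2 * Ke + 1 + K) * (B + 1) * (μ i' + 1 + 1) ≤
            (2 * Ke + 1 + K) * (B + 1) * (μ i + 1) := by gcongr; lia
        nlinarith
  exact fun i s hi => main _ i s rfl hi

/-! ### Derived expressions and simultaneous writes -/

namespace Exp

/-- Negation of a test.  Tests are expressions, every nonzero value counting as true. -/
def not (e : Exp) : Exp := .sub (.const 1) e

/-- The test `e ≤ f`. -/
def le (e f : Exp) : Exp := not (.sub e f)

/-- The test `e < f`. -/
def lt (e f : Exp) : Exp := not (le f e)

/-- The test `e = f`. -/
def eq (e f : Exp) : Exp := .mul (le e f) (le f e)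

/-- The value of `e` if `b` is true, and the value of `f` otherwise. -/
def sel (b e f : Exp) : Exp := .add (.mul (not (not b)) e) (.mul (not b) f)

/-- The power `e ^ k` with a constant exponent. -/
def pow (e : Exp) : ℕ → Exp
  | 0 => .const 1
  | k + 1 => .mul (pow e k) e

/-- The remainder of `e` modulo `f`. -/
def mod (e f : Exp) : Exp := .sub e (.mul f (.div e f))

/-- The conjunction of the tests `P i` for `i < n`. -/
def all (P : ℕ → Exp) : ℕ → Exp
  | 0 => .const 1
  | n + 1 => .mul (all P n) (P n)

/-- The first `i < n` passing the test `P`, and `e` if there is none. -/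
def first (P : ℕ → Exp) (n : ℕ) (e : Exp) : Exp :=
  (List.range n).foldr (fun i f => sel (P i) (.const i) f) e

variable {s : State} {e f b : Exp}

lemma eval_not : (not e).eval s = if e.eval s = 0 then 1 else 0 := by
  simp only [not, Exp.eval]; split_ifs <;> lia

lemma eval_le : (le e f).eval s = if e.eval s ≤ f.eval s then 1 else 0 := by
  simp only [le, eval_not, Exp.eval]; split_ifs <;> lia

lemma eval_le_ne_zero : (le e f).eval s ≠ 0 ↔ e.eval s ≤ f.eval s := by
  rw [eval_le]; split_ifs <;> simp [*]

lemma eval_lt : (lt e f).eval s = if e.eval s < f.eval s then 1 else 0 := by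
  simp only [lt, eval_not, eval_le]; split_ifs <;> lia

lemma eval_eq : (eq e f).eval s = if e.eval s = f.eval s then 1 else 0 := by
  simp only [eq, Exp.eval, eval_le]; split_ifs <;> lia

lemma eval_sel : (sel b e f).eval s = if b.eval s ≠ 0 then e.eval s else f.eval s := by
  simp only [sel, Exp.eval, eval_not]; split_ifs <;> lia

lemma eval_pow (k : ℕ) : (pow e k).eval s = e.eval s ^ k := by
  induction k with
  | zero => rfl
  | succ k ih => simp only [pow, Exp.eval, ih, pow_succ]

lemma eval_mod : (mod e f).eval s = e.eval s % f.eval s := by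
  simp only [mod, Exp.eval]
  have := Nat.div_add_mod (e.eval s) (f.eval s)
  lia

lemma eval_all {P : ℕ → Exp} {n : ℕ} : (all P n).eval s ≠ 0 ↔ ∀ i < n, (P i).eval s ≠ 0 := by
  induction n with
  | zero => simp [all, Exp.eval]
  | succ n ih =>
    simp only [all, Exp.eval, mul_ne_zero_iff, ih]
    constructor
    · rintro ⟨h1, h2⟩ i hi
      rcases (Nat.lt_succ_iff.1 hi).lt_or_eq with h | rfl
      · exact h1 i h
      · exact h2
    · exact fun h => ⟨fun i hi => h i (by lia), h n (by lia)⟩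

lemma eval_first (P : ℕ → Exp) (n : ℕ) :
    (∃ i < n, (P i).eval s ≠ 0 ∧ (∀ i' < i, (P i').eval s = 0) ∧ (first P n e).eval s = i) ∨
      (∀ i < n, (P i).eval s = 0) ∧ (first P n e).eval s = e.eval s := by
  have key : ∀ k n, (∃ i, k ≤ i ∧ i < k + n ∧ (P i).eval s ≠ 0 ∧
      (∀ i', k ≤ i' → i' < i → (P i').eval s = 0) ∧
      ((List.range' k n).foldr (fun i f => sel (P i) (.const i) f) e).eval s = i) ∨
      (∀ i, k ≤ i → i < k + n → (P i).eval s = 0) ∧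
      ((List.range' k n).foldr (fun i f => sel (P i) (.const i) f) e).eval s = e.eval s := by
    intro k n
    induction n generalizing k with
    | zero => exact Or.inr ⟨fun i _ _ => by lia, rfl⟩
    | succ n ih =>
      simp only [List.range'_succ, List.foldr_cons, eval_sel]
      by_cases h : (P k).eval s = 0
      · simp only [h, ne_eq, not_true_eq_false, if_false]
        have hk : ∀ i', k ≤ i' → ¬ k + 1 ≤ i' → (P i').eval s = 0 := by
          intro i' h1 h2
          rwa [show i' = k by lia]
        rcases ih (k + 1) with ⟨i, h1, h2, h3, h4, h5⟩ | ⟨h1, h2⟩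
        · refine Or.inl ⟨i, by lia, by lia, h3, fun i' h6 h7 => ?_, h5⟩
          by_cases h8 : k + 1 ≤ i'
          · exact h4 i' h8 h7
          · exact hk i' h6 h8
        · refine Or.inr ⟨fun i' h6 h7 => ?_, h2⟩
          by_cases h8 : k + 1 ≤ i'
          · exact h1 i' h8 (by lia)
          · exact hk i' h6 h8
      · refine Or.inl ⟨k, le_rfl, by lia, h, fun i' h1 h2 => by lia, ?_⟩
        simp [h, Exp.eval]
  rcases key 0 n with ⟨i, h1, h2, h3, h4, h5⟩ | ⟨h1, h2⟩
  · exact Or.inl ⟨i, by lia, h3, fun i' => h4 i' (Nat.zero_le _), by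
      rwa [← List.range_eq_range'] at h5⟩
  · exact Or.inr ⟨fun i hi => h1 i (Nat.zero_le _) (by lia), by rwa [← List.range_eq_range'] at h2⟩

/-- The expression reads only the arrays of `A` and the cell `k` of array `a`. -/
def ReadsOnly (A : Finset ℕ) (a k : ℕ) : Exp → Prop
  | .const _ => True
  | .read b e => ReadsOnly A a k e ∧ (b ∈ A ∨ b = a ∧ e = .const k)
  | .add e f => ReadsOnly A a k e ∧ ReadsOnly A a k f
  | .sub e f => ReadsOnly A a k e ∧ ReadsOnly A a k f
  | .mul e f => ReadsOnly A a k e ∧ ReadsOnly A a k f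
  | .div e f => ReadsOnly A a k e ∧ ReadsOnly A a k f

lemma ReadsOnly.eval_congr {A : Finset ℕ} {a k : ℕ} {e : Exp} (he : ReadsOnly A a k e)
    {s s' : State} (hA : ∀ b ∈ A, s b = s' b) (ha : s a k = s' a k) : e.eval s = e.eval s' := by
  induction e with
  | const _ => rfl
  | read b e ih =>
    simp only [Exp.eval, ih he.1]
    rcases he.2 with h | ⟨rfl, rfl⟩
    · rw [hA b h]
    · exact ha
  | add e f ihe ihf | sub e f ihe ihf | mul e f ihe ihf | div e f ihe ihf =>
    simp only [Exp.eval, ihe he.1, ihf he.2]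

end Exp

/-- The program storing the value of `E a k` in cell `k` of array `a`, for all `(a, k)` in the list
`L`. -/
def Program.writeAll (E : ℕ → ℕ → Exp) : List (ℕ × ℕ) → Program
  | [] => .skip
  | p :: L => .seq (.write p.1 (.const p.2) (E p.1 p.2)) (writeAll E L)

lemma Program.loopFree_writeAll (E : ℕ → ℕ → Exp) (L : List (ℕ × ℕ)) :
    (writeAll E L).LoopFree := by
  induction L with
  | nil => trivial
  | cons p L ih => exact ⟨trivial, ih⟩

/-- If the expression for a cell does not read the other cells of the list, then the writes take
place simultaneously. -/
lemma Program.run_writeAll {E : ℕ → ℕ → Exp} {A : Finset ℕ} {L : List (ℕ × ℕ)} (hL : L.Nodup)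
    (hA : ∀ p ∈ L, p.1 ∉ A) (hE : ∀ p ∈ L, (E p.1 p.2).ReadsOnly A p.1 p.2) (s : State) (a k : ℕ) :
    (writeAll E L).run s a k = if (a, k) ∈ L then (E a k).eval s else s a k := by
  induction L generalizing s with
  | nil => simp [writeAll, run]
  | cons p L ih =>
    simp only [List.nodup_cons] at hL
    simp only [writeAll, run, Exp.eval]
    rw [ih hL.2 (fun q hq => hA q (List.mem_cons_of_mem _ hq))
      (fun q hq => hE q (List.mem_cons_of_mem _ hq))]
    by_cases hmem : (a, k) ∈ L
    · rw [if_pos hmem, if_pos (List.mem_cons_of_mem _ hmem)]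
      refine (hE _ (List.mem_cons_of_mem _ hmem)).eval_congr (fun b hb => ?_) ?_
      · ext r
        rw [State.set_apply, if_neg]
        rintro ⟨rfl, -⟩
        exact hA p List.mem_cons_self hb
      · rw [State.set_apply, if_neg]
        rintro ⟨rfl, rfl⟩
        exact hL.1 hmem
    · rw [if_neg hmem, State.set_apply]
      by_cases hp : a = p.1 ∧ k = p.2
      · obtain ⟨rfl, rfl⟩ := hp
        simp
      · rw [if_neg hp, if_neg]
        intro h
        rcases List.mem_cons.1 h with rfl | h
        · exact hp ⟨rfl, rfl⟩
        · exact hmem h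

end RAM

/-! ### The program -/

namespace ChoreDivision

open RAM RAM.Exp Finset

/-- The number `m` of chores. -/
def choresExp : Exp := .read 0 (.const 0)

/-- The number of the current candidate; its digits to the base `m + 1` are the thresholds. -/
def candExp : Exp := .read 3 (.const 0)

/-- The current chore. -/
def curExp : Exp := .read 3 (.const 1)

/-- The cost of chore `e` for agent `i`. -/
def costExp (i : ℕ) (e : Exp) : Exp := .read 1 (.add (.mul (.const i) choresExp) e)

/-- The threshold chore of the pair `i < i'`; the value `m` means that there is none. -/
def thresholdExp (n i i' : ℕ) : Exp :=
  mod (.div candExp (pow (.add choresExp (.const 1)) (i * n + i'))) (.add choresExp (.const 1))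

/-- The test whether the current chore lies on the side of `i` of the threshold for the pair
`i < i'`, in the order of the chores by the ratio of their costs for `i` and `i'`. -/
def sideExp (n i i' : ℕ) : Exp :=
  .mul (lt (thresholdExp n i i') choresExp)
    (.add
      (lt (.mul (costExp i curExp) (costExp i' (thresholdExp n i i')))
        (.mul (costExp i' curExp) (costExp i (thresholdExp n i i'))))
      (.mul
        (le (.mul (costExp i curExp) (costExp i' (thresholdExp n i i')))
          (.mul (costExp i' curExp) (costExp i (thresholdExp n i i'))))
        (le (thresholdExp n i i') curExp)))

/-- The test whether agent `i` gets the current chore in the comparison with `i'`. -/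
def beatsExp (n i i' : ℕ) : Exp :=
  if i < i' then sideExp n i i' else if i' < i then not (sideExp n i' i) else .const 1

/-- The agent who gets the current chore: the first one for whom it costs nothing or, if there is
none, the one who gets it in all comparisons. -/
def recipientExp (n : ℕ) : Exp :=
  first (fun i => not (costExp i curExp)) n
    (first (fun i => all (beatsExp n i) n) n (.const 0))

/-- Numerator of the length from `i = l / n` to `i' = l % n`; cell `l` of array 6 holds `a + 1` for
a chore `a` of `i` with the least ratio of the costs for `i'` and `i`, or 0 for infinite length. -/
def numExp (n l : ℕ) : Exp :=
  sel (.read 6 (.const l)) (costExp (l % n) (.sub (.read 6 (.const l)) (.const 1))) (.const 1)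

/-- Denominator of the length from `l / n` to `l % n`; it is 0 for infinite length. -/
def denExp (n l : ℕ) : Exp :=
  sel (.read 6 (.const l)) (costExp (l / n) (.sub (.read 6 (.const l)) (.const 1))) (.const 0)

/-- The new content of cell `l` of array `a` after the current chore has been handed out.  Array 4
holds the cost for `l / n` of the bundle of `l % n`, array 5 the largest cost for `l / n` of a chore
in her own bundle, array 6 the chore that determines the length from `l / n` to `l % n`. -/
def updateExp (n a l : ℕ) : Exp :=
  if a = 4 then
    .add (.read 4 (.const l))
      (.mul (eq (.read 2 curExp) (.const (l % n))) (costExp (l / n) curExp))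
  else if a = 5 then
    sel (.mul (eq (.read 2 curExp) (.const (l / n)))
        (lt (.read 5 (.const l)) (costExp (l / n) curExp)))
      (costExp (l / n) curExp) (.read 5 (.const l))
  else
    sel (.mul (eq (.read 2 curExp) (.const (l / n)))
        (lt (.mul (costExp (l % n) curExp) (denExp n l))
          (.mul (numExp n l) (costExp (l / n) curExp))))
      (.add curExp (.const 1)) (.read 6 (.const l))

/-- Numerator and denominator of the entries computed by the Floyd–Warshall recursion. -/
def shortestExp (n : ℕ) : ℕ → ℕ → ℕ → Exp × Exp
  | 0, i, i' => (numExp n (i * n + i'), denExp n (i * n + i'))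
  | k + 1, i, i' =>
    let o := shortestExp n k i i'
    let p := shortestExp n k i k
    let q := shortestExp n k k i'
    let t := lt (.mul (.mul p.1 q.1) o.2) (.mul o.1 (.mul p.2 q.2))
    (sel t (.mul p.1 q.1) o.1, sel t (.mul p.2 q.2) o.2)

/-- The test whether the completed allocation is EF1 and supported by weights. -/
def checkExp (n : ℕ) : Exp :=
  .mul
    (all (fun i => all (fun i' => le (.read 4 (.const (i * n + i)))
      (.add (.read 4 (.const (i * n + i'))) (.read 5 (.const (i * n + i'))))) n) n)
    (all (fun i => le (shortestExp n n i i).2 (shortestExp n n i i).1) n)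

/-- The cells of the arrays 4, 5 and 6. -/
def tableCells (n : ℕ) : List (ℕ × ℕ) := [4, 5, 6] ×ˢ List.range (n * n)

/-- Hand out the current chore and pass on to the next one. -/
def chorePart (n : ℕ) : Program :=
  .seq (.write 2 curExp (recipientExp n))
    (.seq (.writeAll (updateExp n) (tableCells n))
      (.write 3 (.const 1) (.add curExp (.const 1))))

/-- Pass on to the next candidate. -/
def candidatePart (n : ℕ) : Program :=
  .seq (.writeAll (fun _ _ => .const 0) (tableCells n))
    (.seq (.write 3 (.const 1) (.const 0)) (.write 3 (.const 0) (.add candExp (.const 1))))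

/-- The loop continues until all chores are handed out and the allocation passes the test. -/
def guardExp (n : ℕ) : Exp := .add (lt curExp choresExp) (not (checkExp n))

/-- One round of the loop. -/
def bodyProgram (n : ℕ) : Program := .ite (lt curExp choresExp) (chorePart n) (candidatePart n)

lemma loopFree_bodyProgram (n : ℕ) : (bodyProgram n).LoopFree :=
  ⟨⟨trivial, Program.loopFree_writeAll _ _, trivial⟩, Program.loopFree_writeAll _ _, trivial, trivial⟩

lemma mem_tableCells {n a l : ℕ} :
    (a, l) ∈ tableCells n ↔ (a = 4 ∨ a = 5 ∨ a = 6) ∧ l < n * n := by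
  simp [tableCells]
  grind

lemma nodup_tableCells (n : ℕ) : (tableCells n).Nodup :=
  List.Nodup.product (by decide) List.nodup_range

lemma readsOnly_updateExp {n : ℕ} {p : ℕ × ℕ} (hp : p ∈ tableCells n) :
    (updateExp n p.1 p.2).ReadsOnly {0, 1, 2, 3} p.1 p.2 := by
  obtain ⟨a, l⟩ := p
  rcases (mem_tableCells.1 hp).1 with rfl | rfl | rfl <;>
  simp [updateExp, ReadsOnly, RAM.Exp.eq, RAM.Exp.le, RAM.Exp.lt, RAM.Exp.not, sel, curExp, costExp,
    choresExp, numExp, denExp]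

/-! ### The meaning of the program -/

/-- The chore `j` is on the side of `i` of the threshold for `i < i'` in candidate `q`.  Here
`C i j` is the cost of chore `j` for agent `i`. -/
def Side (n m : ℕ) (C : ℕ → ℕ → ℕ) (q i i' j : ℕ) : Prop :=
  q / (m + 1) ^ (i * n + i') % (m + 1) < m ∧
    (C i j * C i' (q / (m + 1) ^ (i * n + i') % (m + 1)) <
        C i' j * C i (q / (m + 1) ^ (i * n + i') % (m + 1)) ∨
      C i j * C i' (q / (m + 1) ^ (i * n + i') % (m + 1)) ≤
        C i' j * C i (q / (m + 1) ^ (i * n + i') % (m + 1)) ∧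
      q / (m + 1) ^ (i * n + i') % (m + 1) ≤ j)

/-- Agent `v` is the recipient of chore `j` in candidate `q`. -/
def IsRecipient (n m : ℕ) (C : ℕ → ℕ → ℕ) (q j v : ℕ) : Prop :=
  v < n ∧ ((∃ i < n, C i j = 0) → C v j = 0 ∧ ∀ i < v, C i j ≠ 0) ∧
    ((∀ i < n, C i j ≠ 0) → ∀ i < n, (∀ i' < n, (i < i' → Side n m C q i i' j) ∧
      (i' < i → ¬ Side n m C q i' i j)) → v = i)

/-- `M` is the largest cost for `i` of a chore below `j` in her bundle, or 0 if there is none. -/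
def IsMaxCost (C : ℕ → ℕ → ℕ) (x : ℕ → ℕ) (i j M : ℕ) : Prop :=
  (∀ j' < j, x j' = i → C i j' ≤ M) ∧ (M = 0 ∨ ∃ j' < j, x j' = i ∧ M = C i j')

/-- `A = a + 1` for a chore `a < j` of `i` with the least ratio of the costs for `i'` and `i`, or
`A = 0` if `i` has no costly chore below `j`. -/
def IsArgmin (C : ℕ → ℕ → ℕ) (x : ℕ → ℕ) (i i' j A : ℕ) : Prop :=
  (A = 0 ∨ ∃ a < j, A = a + 1 ∧ x a = i ∧ C i a ≠ 0) ∧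
    ∀ j' < j, x j' = i → C i j' ≠ 0 → A ≠ 0 ∧ C i' (A - 1) * C i j' ≤ C i' j' * C i (A - 1)

/-- The state of the memory when in candidate number `p.1` the chores below `p.2` have been handed
out. -/
structure Inv (n m : ℕ) (inp : ℕ → ℕ) (Q B : ℕ) (p : ℕ × ℕ) (s : State) : Prop where
  chores : s 0 0 = m
  input : s 1 = inp
  cand : s 3 0 = p.1
  cur : s 3 1 = p.2
  cand_le : p.1 ≤ Q
  cur_le : p.2 ≤ m
  recipient : ∀ j < p.2, IsRecipient n m (fun i j => inp (i * m + j)) p.1 j (s 2 j)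
  sums : ∀ l < n * n, s 4 l = ∑ j ∈ range p.2 with s 2 j = l % n, inp (l / n * m + j)
  maxs : ∀ l < n * n, IsMaxCost (fun i j => inp (i * m + j)) (s 2) (l / n) p.2 (s 5 l)
  argmins : ∀ l < n * n, IsArgmin (fun i j => inp (i * m + j)) (s 2) (l / n) (l % n) p.2 (s 6 l)
  bounded : Bounded B s

section Eval

variable {n m : ℕ} {inp : ℕ → ℕ} {Q B : ℕ} {p : ℕ × ℕ} {s : State}

lemma eval_costExp (h0 : s 0 0 = m) (h1 : s 1 = inp) (i : ℕ) (e : Exp) :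
    (costExp i e).eval s = inp (i * m + e.eval s) := by
  simp [costExp, Exp.eval, choresExp, h0, h1]

lemma eval_sideExp (h : Inv n m inp Q B p s) (i i' : ℕ) :
    (sideExp n i i').eval s ≠ 0 ↔ Side n m (fun i j => inp (i * m + j)) p.1 i i' p.2 := by
  have hthr : (thresholdExp n i i').eval s = p.1 / (m + 1) ^ (i * n + i') % (m + 1) := by
    simp [thresholdExp, eval_mod, Exp.eval, eval_pow, choresExp, candExp, h.chores, h.cand]
  have hcur : curExp.eval s = p.2 := by simp [curExp, Exp.eval, h.cur]
  have hch : choresExp.eval s = m := by simp [choresExp, Exp.eval, h.chores]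
  simp only [sideExp, Exp.eval, eval_lt, eval_le, eval_costExp h.chores h.input, hthr, hcur, hch,
    Side]
  split_ifs <;> simp_all

lemma isRecipient_eval (hn : 0 < n) (h : Inv n m inp Q B p s) :
    IsRecipient n m (fun i j => inp (i * m + j)) p.1 p.2 ((recipientExp n).eval s) := by
  have hcur : curExp.eval s = p.2 := by simp [curExp, Exp.eval, h.cur]
  have hbeats : ∀ i, (all (beatsExp n i) n).eval s ≠ 0 ↔ ∀ i' < n,
      (i < i' → Side n m (fun i j => inp (i * m + j)) p.1 i i' p.2) ∧
      (i' < i → ¬ Side n m (fun i j => inp (i * m + j)) p.1 i' i p.2) := by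
    intro i
    rw [eval_all]
    refine forall₂_congr fun i' _ => ?_
    unfold beatsExp
    rcases lt_trichotomy i i' with hlt | rfl | hlt
    · simp [hlt, hlt.not_gt, eval_sideExp h]
    · simp [Exp.eval]
    · simp [hlt, hlt.not_gt, eval_not, ← eval_sideExp h]
  have hzero : ∀ i, (not (costExp i curExp)).eval s ≠ 0 ↔ inp (i * m + p.2) = 0 := by
    intro i
    simp [eval_not, eval_costExp h.chores h.input, hcur]
  have hzero' : ∀ i, (not (costExp i curExp)).eval s = 0 ↔ inp (i * m + p.2) ≠ 0 := fun i => by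
    rw [ne_eq, ← hzero i, not_not]
  unfold recipientExp
  rcases eval_first (s := s) (e := first (fun i => all (beatsExp n i) n) n (.const 0))
    (fun i => not (costExp i curExp)) n with ⟨i, hi, h1, h2, h3⟩ | ⟨h1, h3⟩
  · rw [h3]
    exact ⟨hi, fun _ => ⟨(hzero i).1 h1, fun i' hi' => (hzero' i').1 (h2 i' hi')⟩,
      fun h' => absurd ((hzero i).1 h1) (h' i hi)⟩
  · have hpos : ∀ i < n, inp (i * m + p.2) ≠ 0 := fun i hi => (hzero' i).1 (h1 i hi)
    have hex : ¬ ∃ i < n, inp (i * m + p.2) = 0 := by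
      push Not
      exact hpos
    rw [h3]
    rcases eval_first (s := s) (e := .const 0) (fun i => all (beatsExp n i) n) n with
      ⟨i, hi, h4, h5, h6⟩ | ⟨h4, h6⟩
    · rw [h6]
      refine ⟨hi, fun h' => absurd h' hex, fun _ k hk hkb => ?_⟩
      have hki := (hbeats k).2 hkb
      have hle : i ≤ k := by
        by_contra hcon
        exact hki (h5 k (by lia))
      by_contra hne
      exact (hkb i hi).2 (by lia) ((((hbeats i).1 h4) k hk).1 (by lia))
    · rw [h6]
      exact ⟨hn, fun h' => absurd h' hex, fun _ k hk hkb => absurd (h4 k hk) ((hbeats k).2 hkb)⟩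

end Eval

lemma sum_filter_range_succ (x : ℕ → ℕ) (f : ℕ → ℕ) (i j : ℕ) :
    ∑ k ∈ range (j + 1) with x k = i, f k =
      ∑ k ∈ range j with x k = i, f k + if x j = i then f j else 0 := by
  simp only [sum_filter, sum_range_succ]

lemma IsMaxCost.succ {C : ℕ → ℕ → ℕ} {x : ℕ → ℕ} {i j M : ℕ} (h : IsMaxCost C x i j M) :
    IsMaxCost C x i (j + 1) (if x j = i ∧ M < C i j then C i j else M) := by
  obtain ⟨h1, h2⟩ := h
  split_ifs with hc
  · refine ⟨fun j' hj' hx => ?_, Or.inr ⟨j, by lia, hc.1, rfl⟩⟩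
    rcases (Nat.lt_succ_iff.1 hj').lt_or_eq with h | rfl
    · exact (h1 j' h hx).trans hc.2.le
    · exact le_rfl
  · refine ⟨fun j' hj' hx => ?_, ?_⟩
    · rcases (Nat.lt_succ_iff.1 hj').lt_or_eq with h | rfl
      · exact h1 j' h hx
      · by_contra hcon
        exact hc ⟨hx, by lia⟩
    · rcases h2 with h2 | ⟨j', h3, h4⟩
      · exact Or.inl h2
      · exact Or.inr ⟨j', by lia, h4⟩

lemma IsArgmin.succ {C : ℕ → ℕ → ℕ} {x : ℕ → ℕ} {i i' j A : ℕ} (h : IsArgmin C x i i' j A) :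
    IsArgmin C x i i' (j + 1) (if x j = i ∧ C i' j * (if A ≠ 0 then C i (A - 1) else 0) <
      (if A ≠ 0 then C i' (A - 1) else 1) * C i j then j + 1 else A) := by
  obtain ⟨h1, h2⟩ := h
  by_cases hc : x j = i ∧ C i' j * (if A ≠ 0 then C i (A - 1) else 0) <
      (if A ≠ 0 then C i' (A - 1) else 1) * C i j
  · rw [if_pos hc]
    have hj0 : C i j ≠ 0 := by
      intro h0
      simp [h0] at hc
    refine ⟨Or.inr ⟨j, by lia, rfl, hc.1, hj0⟩, fun j' hj' hx h0 => ⟨by lia, ?_⟩⟩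
    rw [Nat.add_sub_cancel]
    rcases (Nat.lt_succ_iff.1 hj').lt_or_eq with h | rfl
    · obtain ⟨hA, h3⟩ := h2 j' h hx h0
      obtain ⟨a, -, rfl, -, ha⟩ := h1.resolve_left hA
      simp only [hA, ne_eq, not_false_eq_true, if_true, Nat.add_sub_cancel] at hc h3
      have ha' : 0 < C i a := Nat.pos_of_ne_zero ha
      refine le_of_mul_le_mul_right ?_ ha'
      calc C i' j * C i j' * C i a = (C i' j * C i a) * C i j' := by ring
        _ ≤ (C i' a * C i j) * C i j' := Nat.mul_le_mul_right _ hc.2.le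
        _ = (C i' a * C i j') * C i j := by ring
        _ ≤ (C i' j' * C i a) * C i j := Nat.mul_le_mul_right _ h3
        _ = C i' j' * C i j * C i a := by ring
    · exact le_rfl
  · rw [if_neg hc]
    refine ⟨?_, fun j' hj' hx h0 => ?_⟩
    · rcases h1 with h1 | ⟨a, h3, h4⟩
      · exact Or.inl h1
      · exact Or.inr ⟨a, by lia, h4⟩
    · rcases (Nat.lt_succ_iff.1 hj').lt_or_eq with h | rfl
      · exact h2 j' h hx h0
      · have hle : (if A ≠ 0 then C i' (A - 1) else 1) * C i j' ≤
            C i' j' * (if A ≠ 0 then C i (A - 1) else 0) := by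
          by_contra hcon
          exact hc ⟨hx, by lia⟩
        by_cases hA : A = 0
        · simp [hA, h0] at hle
        · simp only [hA, ne_eq, not_false_eq_true, if_true] at hle
          exact ⟨hA, hle⟩

/-- The number bounds needed for the memory to stay bounded by `B`. -/
structure SizeBound (n m : ℕ) (inp : ℕ → ℕ) (Q B : ℕ) : Prop where
  agents : n.size ≤ B
  chores : m.size ≤ B
  cand : Q.size ≤ B
  input : ∀ k, (inp k).size ≤ B
  sums : ∀ i, (∑ j ∈ range m, inp (i * m + j)).size ≤ B

lemma Inv.chorePart {n m : ℕ} {inp : ℕ → ℕ} {Q B q j : ℕ} {s : State} (hn : 0 < n)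
    (hB : SizeBound n m inp Q B) (h : Inv n m inp Q B (q, j) s) (hj : j < m) :
    Inv n m inp Q B (q, j + 1) ((chorePart n).run s) := by
  set v := (recipientExp n).eval s with hv
  have hrec := isRecipient_eval hn h
  rw [← hv] at hrec
  simp only at hrec
  have hcur : s 3 1 = j := h.cur
  set s1 := s.set 2 j v with hs1
  have hrun : ∀ a k, (ChoreDivision.chorePart n).run s a k = if a = 3 ∧ k = 1 then j + 1 else
      if (a, k) ∈ tableCells n then (updateExp n a k).eval s1 else if a = 2 ∧ k = j then v
      else s a k := by
    intro a k
    have hw := Program.run_writeAll (E := updateExp n) (A := {0, 1, 2, 3}) (nodup_tableCells n)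
      (fun p hp => by
        obtain ⟨a, l⟩ := p
        rcases (mem_tableCells.1 hp).1 with rfl | rfl | rfl <;> simp)
      (fun p hp => readsOnly_updateExp hp) s1
    have hc1 : ∀ t : State, curExp.eval t = t 3 1 := fun _ => rfl
    simp only [ChoreDivision.chorePart, Program.run, Exp.eval, hc1, hcur, ← hv, ← hs1,
      State.set_apply, hw]
    have : (3, 1) ∉ tableCells n := by simp [mem_tableCells]
    rw [if_neg this]
    have h31 : s1 3 1 = j := by rw [hs1, State.set_apply]; simp [hcur]
    have hak : s1 a k = if a = 2 ∧ k = j then v else s a k := by rw [hs1, State.set_apply]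
    rw [h31, hak]
  have e0 : s1 0 0 = m := by rw [hs1, State.set_apply]; simp [h.chores]
  have e1 : s1 1 = inp := by
    ext k
    rw [hs1, State.set_apply]
    simp [h.input]
  have e2 : s1 2 j = v := by rw [hs1, State.set_apply]; simp
  have e3 : curExp.eval s1 = j := by
    change s1 3 1 = j
    rw [hs1, State.set_apply]; simp [hcur]
  have eother : ∀ a ≠ 2, s1 a = s a := by
    intro a ha
    ext k
    rw [hs1, State.set_apply]
    simp [ha]
  set t := (ChoreDivision.chorePart n).run s with ht
  have t2j : t 2 j = v := by rw [hrun]; simp [mem_tableCells]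
  have t2 : ∀ k ≠ j, t 2 k = s 2 k := by
    intro k hk
    rw [hrun]; simp [mem_tableCells, hk]
  have t4 : ∀ l < n * n, t 4 l = s 4 l + if v = l % n then inp (l / n * m + j) else 0 := by
    intro l hl
    rw [hrun, if_neg (by simp), if_pos (mem_tableCells.2 ⟨by simp, hl⟩)]
    simp [updateExp, Exp.eval, eval_eq, eval_costExp e0 e1, e3, e2, eother 4]
  have t5 : ∀ l < n * n, t 5 l = if v = l / n ∧ s 5 l < inp (l / n * m + j) then
      inp (l / n * m + j) else s 5 l := by
    intro l hl
    rw [hrun, if_neg (by simp), if_pos (mem_tableCells.2 ⟨by simp, hl⟩)]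
    simp [updateExp, Exp.eval, eval_eq, eval_lt, eval_sel, eval_costExp e0 e1, e3, e2, eother 5]
    exact if_congr and_comm rfl rfl
  have t6 : ∀ l < n * n, t 6 l = if v = l / n ∧
      inp (l % n * m + j) * (if s 6 l ≠ 0 then inp (l / n * m + (s 6 l - 1)) else 0) <
      (if s 6 l ≠ 0 then inp (l % n * m + (s 6 l - 1)) else 1) * inp (l / n * m + j) then
      j + 1 else s 6 l := by
    intro l hl
    rw [hrun, if_neg (by simp), if_pos (mem_tableCells.2 ⟨by simp, hl⟩)]
    simp only [updateExp, numExp, denExp, Exp.eval, eval_eq, eval_lt, eval_sel, eval_costExp e0 e1,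
      e3, e2, eother 6 (by decide), if_neg (show ¬ (6 : ℕ) = 4 by decide),
      if_neg (show ¬ (6 : ℕ) = 5 by decide)]
    refine if_congr ?_ rfl rfl
    simp only [mul_ne_zero_iff, ne_eq, ite_eq_right_iff, one_ne_zero, imp_false, not_not]
  have sums' : ∀ l < n * n, t 4 l = ∑ k ∈ range (j + 1) with t 2 k = l % n, inp (l / n * m + k) := by
    intro l hl
    rw [t4 l hl, sum_filter_range_succ, t2j, h.sums l hl]
    congr 1
    refine sum_congr (filter_congr fun k hk => ?_) fun _ _ => rfl
    rw [t2 k (by simp at hk; lia)]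
  have hmaxcongr : ∀ {i M}, IsMaxCost (fun i j => inp (i * m + j)) (s 2) i j M →
      IsMaxCost (fun i j => inp (i * m + j)) (t 2) i j M := by
    rintro i M ⟨h1, h2⟩
    refine ⟨fun j' hj' hx => h1 j' hj' (by rwa [t2 j' (by lia)] at hx), h2.imp_right ?_⟩
    rintro ⟨j', h3, h4, h5⟩
    exact ⟨j', h3, by rwa [t2 j' (by lia)], h5⟩
  have hargcongr : ∀ {i i' A}, IsArgmin (fun i j => inp (i * m + j)) (s 2) i i' j A →
      IsArgmin (fun i j => inp (i * m + j)) (t 2) i i' j A := by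
    rintro i i' A ⟨h1, h2⟩
    refine ⟨h1.imp_right ?_, fun j' hj' hx => h2 j' hj' (by rwa [t2 j' (by lia)] at hx)⟩
    rintro ⟨j', h3, h4, h5, h6⟩
    exact ⟨j', h3, h4, by rwa [t2 j' (by lia)], h6⟩
  have maxs' : ∀ l < n * n,
      IsMaxCost (fun i j => inp (i * m + j)) (t 2) (l / n) (j + 1) (t 5 l) := by
    intro l hl
    have := (hmaxcongr (h.maxs l hl)).succ
    rw [t2j] at this
    rwa [t5 l hl]
  have argmins' : ∀ l < n * n,
      IsArgmin (fun i j => inp (i * m + j)) (t 2) (l / n) (l % n) (j + 1) (t 6 l) := by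
    intro l hl
    have := (hargcongr (h.argmins l hl)).succ
    rw [t2j] at this
    rwa [t6 l hl]
  refine ⟨?_, ?_, ?_, ?_, h.cand_le, hj, ?_, sums', maxs', argmins', ?_⟩
  · rw [hrun]; simp [mem_tableCells, h.chores]
  · ext k; rw [hrun]; simp [mem_tableCells, h.input]
  · rw [hrun]; simpa [mem_tableCells] using h.cand
  · rw [hrun]; simp
  · intro k hk
    simp only at hk
    by_cases hkj : k = j
    · subst hkj; rw [t2j]; exact hrec
    · rw [t2 k hkj]; exact h.recipient k (by simp only; lia)
  · intro a k
    by_cases hmem : (a, k) ∈ tableCells n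
    · obtain ⟨ha, hk⟩ := mem_tableCells.1 hmem
      rcases ha with rfl | rfl | rfl
      · rw [sums' k hk]
        refine (Nat.size_le_size ?_).trans (hB.sums (k / n))
        exact sum_le_sum_of_subset ((filter_subset _ _).trans (range_subset_range.2 hj))
      · rcases (maxs' k hk).2 with h0 | ⟨j', -, -, h0⟩
        · rw [h0]; simp
        · rw [h0]; exact hB.input _
      · rcases (argmins' k hk).1 with h0 | ⟨j', hj', h0, -⟩
        · rw [h0]; simp
        · rw [h0]; exact (Nat.size_le_size (by lia)).trans hB.chores
    · rw [hrun, if_neg hmem]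
      split_ifs
      · exact (Nat.size_le_size (by lia)).trans hB.chores
      · exact (Nat.size_le_size hrec.1.le).trans hB.agents
      · exact h.bounded a k

lemma Inv.candidatePart {n m : ℕ} {inp : ℕ → ℕ} {Q B q j : ℕ} {s : State}
    (hB : SizeBound n m inp Q B) (h : Inv n m inp Q B (q, j) s) (hq : q < Q) :
    Inv n m inp Q B (q + 1, 0) ((candidatePart n).run s) := by
  have hrun : ∀ a k, (ChoreDivision.candidatePart n).run s a k = if a = 3 ∧ k = 0 then q + 1 else
      if a = 3 ∧ k = 1 then 0 else if (a, k) ∈ tableCells n then 0 else s a k := by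
    intro a k
    have hw := Program.run_writeAll (E := fun _ _ => .const 0) (A := ∅) (nodup_tableCells n)
      (fun p hp => by simp) (fun p hp => trivial) s
    have hc1 : ∀ t : State, candExp.eval t = t 3 0 := fun _ => rfl
    have hq : s 3 0 = q := h.cand
    simp only [ChoreDivision.candidatePart, Program.run, Exp.eval, hc1, State.set_apply, hw]
    simp [mem_tableCells, hq]
  set t := (ChoreDivision.candidatePart n).run s with ht
  have ht0 : ∀ a l, (a = 4 ∨ a = 5 ∨ a = 6) → l < n * n → t a l = 0 := by
    intro a l ha hl
    rw [hrun, if_neg (by lia), if_neg (by lia), if_pos (mem_tableCells.2 ⟨ha, hl⟩)]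
  refine ⟨?_, ?_, ?_, ?_, hq, Nat.zero_le _, ?_, ?_, ?_, ?_, ?_⟩
  · rw [hrun]; simp [mem_tableCells, h.chores]
  · ext k; rw [hrun]; simp [mem_tableCells, h.input]
  · rw [hrun]; simp
  · rw [hrun]; simp
  · intro k hk; simp at hk
  · intro l hl
    rw [ht0 4 l (by simp) hl]; simp
  · intro l hl
    rw [ht0 5 l (by simp) hl]
    exact ⟨fun j' hj' => absurd hj' (Nat.not_lt_zero _), Or.inl rfl⟩
  · intro l hl
    rw [ht0 6 l (by simp) hl]
    exact ⟨Or.inl rfl, fun j' hj' => absurd hj' (Nat.not_lt_zero _)⟩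
  · intro a k
    rw [hrun]
    split_ifs
    · exact (Nat.size_le_size hq).trans hB.cand
    · simp
    · simp
    · exact h.bounded a k

end ChoreDivision

/-! ### Correctness of the test -/

namespace ChoreDivision

open RAM RAM.Exp Finset
open scoped ENNReal

lemma natCast_div_lt_iff {a b c d : ℕ} (ha : a ≠ 0) (hc : c ≠ 0) :
    (a : ℝ≥0∞) / b < c / d ↔ a * d < c * b := by
  have ha' : (a : ℝ≥0∞) ≠ 0 := by exact_mod_cast ha
  have hc' : (c : ℝ≥0∞) ≠ 0 := by exact_mod_cast hc
  rcases Nat.eq_zero_or_pos b with rfl | hb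
  · simp [ENNReal.div_zero ha']
  rcases Nat.eq_zero_or_pos d with rfl | hd
  · have : (a : ℝ≥0∞) / b < ∞ := ENNReal.div_lt_top (by simp) (by exact_mod_cast hb.ne')
    simp [ENNReal.div_zero hc', this, hb, Nat.pos_of_ne_zero hc]
  have hb' : (b : ℝ≥0∞) ≠ 0 := by exact_mod_cast hb.ne'
  have hd' : (d : ℝ≥0∞) ≠ 0 := by exact_mod_cast hd.ne'
  rw [ENNReal.div_lt_iff (Or.inl hb') (Or.inl (by simp)), ENNReal.mul_comm_div, ← mul_div_assoc,
    ENNReal.lt_div_iff_mul_lt (Or.inl hd') (Or.inl (by simp))]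
  exact_mod_cast Iff.rfl

lemma natCast_div_mul_div (a b c d : ℕ) :
    (a : ℝ≥0∞) / b * (c / d) = ((a * c : ℕ) : ℝ≥0∞) / ((b * d : ℕ) : ℝ≥0∞) := by
  push_cast
  rw [div_eq_mul_inv, div_eq_mul_inv, div_eq_mul_inv, ENNReal.mul_inv (by simp) (by simp)]
  ring

/-- The lengths stored in memory, infinite outside the range of the agents. -/
noncomputable def lengthOf (n : ℕ) (s : State) (i i' : ℕ) : ℝ≥0∞ :=
  if i < n ∧ i' < n then ((numExp n (i * n + i')).eval s : ℝ≥0∞) / ((denExp n (i * n + i')).eval s)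
  else ∞

lemma eval_shortestExp {n : ℕ} {s : State}
    (hnum : ∀ i < n, ∀ i' < n, (numExp n (i * n + i')).eval s ≠ 0) :
    ∀ k ≤ n, ∀ i < n, ∀ i' < n, (shortestExp n k i i').1.eval s ≠ 0 ∧
      ((shortestExp n k i i').1.eval s : ℝ≥0∞) / ((shortestExp n k i i').2.eval s) =
        shortest (lengthOf n s) k i i' := by
  intro k
  induction k with
  | zero =>
    intro _ i hi i' hi'
    exact ⟨hnum i hi i' hi', by simp [shortestExp, shortest, lengthOf, hi, hi']⟩
  | succ k ih =>
    intro hk i hi i' hi'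
    obtain ⟨h1, h2⟩ := ih (by lia) i hi i' hi'
    obtain ⟨h3, h4⟩ := ih (by lia) i hi k (by lia)
    obtain ⟨h5, h6⟩ := ih (by lia) k (by lia) i' hi'
    have hlt := natCast_div_lt_iff (b := (shortestExp n k i k).2.eval s *
      (shortestExp n k k i').2.eval s) (d := (shortestExp n k i i').2.eval s) (mul_ne_zero h3 h5) h1
    rw [← natCast_div_mul_div, h2, h4, h6] at hlt
    simp only [shortestExp, shortest, eval_sel, eval_lt, Exp.eval]
    by_cases hc : (shortestExp n k i k).1.eval s * (shortestExp n k k i').1.eval s *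
        (shortestExp n k i i').2.eval s < (shortestExp n k i i').1.eval s *
        ((shortestExp n k i k).2.eval s * (shortestExp n k k i').2.eval s)
    · simp only [hc, if_true, ne_eq, one_ne_zero, not_false_eq_true]
      refine ⟨mul_ne_zero h3 h5, ?_⟩
      rw [min_eq_right (hlt.2 hc).le, ← natCast_div_mul_div, h4, h6]
    · simp only [hc, if_false, ne_eq, not_true_eq_false]
      exact ⟨h1, by rw [min_eq_left (not_lt.1 fun h => hc (hlt.1 h)), h2]⟩

lemma cell_div_mod {n i i' : ℕ} (hi' : i' < n) : (i * n + i') / n = i ∧ (i * n + i') % n = i' := by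
  rw [mul_comm, Nat.mul_add_div (by lia), Nat.mul_add_mod, Nat.div_eq_of_lt hi',
    Nat.mod_eq_of_lt hi']
  simp

lemma cell_lt {n i i' : ℕ} (hi : i < n) (hi' : i' < n) : i * n + i' < n * n := by nlinarith

section Check

variable {n m : ℕ} {inp : ℕ → ℕ} {Q B q : ℕ} {s : State}

lemma eval_numExp (h : Inv n m inp Q B (q, m) s) {i i' : ℕ} (hi' : i' < n) :
    (numExp n (i * n + i')).eval s =
      if s 6 (i * n + i') ≠ 0 then inp (i' * m + (s 6 (i * n + i') - 1)) else 1 := by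
  simp only [numExp, eval_sel, eval_costExp h.chores h.input, Exp.eval, (cell_div_mod hi').2]

lemma eval_denExp (h : Inv n m inp Q B (q, m) s) {i i' : ℕ} (hi' : i' < n) :
    (denExp n (i * n + i')).eval s =
      if s 6 (i * n + i') ≠ 0 then inp (i * m + (s 6 (i * n + i') - 1)) else 0 := by
  simp only [denExp, eval_sel, eval_costExp h.chores h.input, Exp.eval, (cell_div_mod hi').1]

lemma isArgmin_cell (h : Inv n m inp Q B (q, m) s) {i i' : ℕ} (hi : i < n) (hi' : i' < n) :
    IsArgmin (fun i j => inp (i * m + j)) (s 2) i i' m (s 6 (i * n + i')) := by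
  have := h.argmins _ (cell_lt hi hi')
  rwa [(cell_div_mod hi').1, (cell_div_mod hi').2] at this

lemma isMaxCost_cell (h : Inv n m inp Q B (q, m) s) {i i' : ℕ} (hi : i < n) (hi' : i' < n) :
    IsMaxCost (fun i j => inp (i * m + j)) (s 2) i m (s 5 (i * n + i')) := by
  have := h.maxs _ (cell_lt hi hi')
  rwa [(cell_div_mod hi').1] at this

lemma eval_numExp_ne_zero (h : Inv n m inp Q B (q, m) s) {i i' : ℕ} (hi : i < n) (hi' : i' < n) :
    (numExp n (i * n + i')).eval s ≠ 0 := by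
  rw [eval_numExp h hi']
  split_ifs with h6
  · obtain ⟨a, ha, hA, hxa, hne⟩ := (isArgmin_cell h hi hi').1.resolve_left h6
    rw [hA, Nat.add_sub_cancel]
    intro h0
    have := ((h.recipient a ha).2.1 ⟨i', hi', h0⟩).1
    rw [hxa] at this
    exact hne this
  · exact one_ne_zero

lemma lengthOf_ne_zero (h : Inv n m inp Q B (q, m) s) (i i' : ℕ) : lengthOf n s i i' ≠ 0 := by
  unfold lengthOf
  split_ifs with hii
  · simpa using eval_numExp_ne_zero h hii.1 hii.2
  · simp

lemma eval_checkExp (h : Inv n m inp Q B (q, m) s) : (checkExp n).eval s ≠ 0 ↔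
    (∀ i < n, ∀ i' < n, s 4 (i * n + i) ≤ s 4 (i * n + i') + s 5 (i * n + i')) ∧
      ∀ i < n, 1 ≤ shortest (lengthOf n s) n i i := by
  simp only [checkExp, Exp.eval, mul_ne_zero_iff, eval_all, eval_le_ne_zero]
  refine and_congr Iff.rfl (forall₂_congr fun i hi => ?_)
  obtain ⟨h1, h2⟩ := eval_shortestExp (fun i hi i' hi' => eval_numExp_ne_zero h hi hi') n le_rfl
    i hi i hi
  have h3 := natCast_div_lt_iff (b := (shortestExp n n i i).2.eval s) (d := 1) h1 one_ne_zero
  rw [h2] at h3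
  simp only [Nat.cast_one, div_one, mul_one, one_mul] at h3
  rw [← not_lt, ← not_lt, h3]

variable {c : Fin n → Fin m → ℕ} {x : Fin m → Fin n}

lemma sums_eq_cost (h : Inv n m inp Q B (q, m) s) (hinp : ∀ (i : Fin n) (j : Fin m), inp (i * m + j) = c i j)
    (hx : ∀ j : Fin m, s 2 j = x j) (i i' : Fin n) :
    s 4 ((i : ℕ) * n + i') = cost c i (bundle x i') := by
  rw [h.sums _ (cell_lt i.2 i'.2), (cell_div_mod i'.2).1, (cell_div_mod i'.2).2, sum_filter,
    ← Fin.sum_univ_eq_sum_range (fun k => if s 2 k = i' then inp ((i : ℕ) * m + k) else 0) m]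
  unfold cost bundle
  rw [sum_filter]
  refine sum_congr rfl fun j _ => ?_
  rw [hx, hinp]
  exact if_congr Fin.ext_iff.symm rfl rfl

lemma isEF1_of_check (h : Inv n m inp Q B (q, m) s)
    (hinp : ∀ (i : Fin n) (j : Fin m), inp (i * m + j) = c i j) (hx : ∀ j : Fin m, s 2 j = x j)
    (hcheck : (checkExp n).eval s ≠ 0) : IsEF1 c x := by
  intro i i' henvy
  have hc := ((eval_checkExp h).1 hcheck).1 i i.2 i' i'.2
  rw [sums_eq_cost h hinp hx, sums_eq_cost h hinp hx] at hc
  unfold Envies at henvy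
  rcases (isMaxCost_cell h i.2 i'.2).2 with h0 | ⟨j, hj, hxj, hM⟩
  · lia
  · have hxj' : x ⟨j, hj⟩ = i := by
      ext
      rw [← hx ⟨j, hj⟩]
      exact hxj
    have hmem : (⟨j, hj⟩ : Fin m) ∈ bundle x i := by simpa [bundle] using hxj'
    refine ⟨⟨j, hj⟩, hmem, ?_⟩
    have hsum : cost c i (bundle x i \ {⟨j, hj⟩}) + c i ⟨j, hj⟩ = cost c i (bundle x i) := by
      have := sum_sdiff (f := c i) (singleton_subset_iff.2 hmem)
      rwa [sum_singleton] at this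
    have := hinp i ⟨j, hj⟩
    simp only at this hM
    lia

lemma isPO_of_check (h : Inv n m inp Q B (q, m) s)
    (hinp : ∀ (i : Fin n) (j : Fin m), inp (i * m + j) = c i j) (hx : ∀ j : Fin m, s 2 j = x j)
    (hcheck : (checkExp n).eval s ≠ 0) : IsPO c x := by
  obtain ⟨v, hv, hvR⟩ := exists_potential (lengthOf_ne_zero h) ((eval_checkExp h).1 hcheck).2
  have hpos : ∀ i, 0 < (v i).toReal := fun i => ENNReal.toReal_pos (hv i).1 (hv i).2
  refine isPO_of_weights (w := fun i => 1 / (v i).toReal) (fun i => one_div_pos.2 (hpos i))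
    fun j i' => ?_
  by_cases h0 : c (x j) j = 0
  · rw [h0]
    have := hpos i'
    simp only [Nat.cast_zero, mul_zero]
    positivity
  obtain ⟨hA, hmin⟩ := (isArgmin_cell h (x j).2 i'.2).2 j j.2 (hx j) (by simp only [hinp]; exact h0)
  obtain ⟨a, ha, hAa, hxa, hca⟩ := (isArgmin_cell h (x j).2 i'.2).1.resolve_left hA
  have hR := hvR (x j) (x j).2 i'
  rw [lengthOf, if_pos ⟨(x j).2, i'.2⟩, eval_numExp h i'.2, eval_denExp h i'.2, if_pos hA,
    if_pos hA, ← mul_div_assoc, ENNReal.le_div_iff_mul_le (Or.inl (by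
      rw [hAa]; simpa using hca)) (Or.inl (by simp))] at hR
  have hR' := ENNReal.toReal_mono (ENNReal.mul_ne_top (hv _).2 (by simp)) hR
  simp only [ENNReal.toReal_mul, ENNReal.toReal_natCast] at hR'
  simp only [hinp, hAa, Nat.add_sub_cancel] at hR' hmin
  set N := inp ((i' : ℕ) * m + a)
  set D := inp ((x j : ℕ) * m + a) with hD
  have hD0 : (0 : ℝ) < D := by exact_mod_cast Nat.pos_of_ne_zero hca
  have hmin' : (N : ℝ) * c (x j) j ≤ c i' j * D := by exact_mod_cast hmin
  have h1 := hpos (x j)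
  have h2 := hpos i'
  rw [div_mul_eq_mul_div, div_mul_eq_mul_div, one_mul, one_mul, div_le_div_iff₀ h1 h2]
  refine le_of_mul_le_mul_right ?_ hD0
  calc (c (x j) j : ℝ) * (v i').toReal * D = c (x j) j * ((v i').toReal * D) := by ring
    _ ≤ c (x j) j * ((v (x j)).toReal * N) := mul_le_mul_of_nonneg_left hR' (Nat.cast_nonneg _)
    _ = (N * c (x j) j) * (v (x j)).toReal := by ring
    _ ≤ (c i' j * D) * (v (x j)).toReal := by gcongr
    _ = c i' j * (v (x j)).toReal * D := by ring

lemma check_of_supported (h : Inv n m inp Q B (q, m) s)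
    (hinp : ∀ (i : Fin n) (j : Fin m), inp (i * m + j) = c i j) (hx : ∀ j : Fin m, s 2 j = x j)
    {w : Fin n → ℝ} (hw : ∀ i, 0 < w i) (hwx : ∀ j i, w (x j) * c (x j) j ≤ w i * c i j)
    (hef : ∀ i i', cost c i (bundle x i) ≤ cost c i (bundle x i') ∨
        ∃ j, x j = i ∧ cost c i (bundle x i) ≤ cost c i (bundle x i') + c i j) :
    (checkExp n).eval s ≠ 0 := by
  rw [eval_checkExp h]
  constructor
  · intro i hi i' hi'
    have h1 := sums_eq_cost h hinp hx ⟨i, hi⟩ ⟨i, hi⟩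
    have h2 := sums_eq_cost h hinp hx ⟨i, hi⟩ ⟨i', hi'⟩
    simp only at h1 h2
    rw [h1, h2]
    rcases hef ⟨i, hi⟩ ⟨i', hi'⟩ with h3 | ⟨j, hj, h3⟩
    · lia
    · have h4 := (isMaxCost_cell h hi hi').1 j j.2 (by rw [hx, hj])
      have h5 := hinp ⟨i, hi⟩ j
      simp only at h4 h5
      lia
  · refine one_le_shortest (v := fun i => if hi : i < n then ENNReal.ofReal (1 / w ⟨i, hi⟩) else 1)
      (fun i hi => ?_) (fun i hi i' hi' => ?_)
    · simp only [dif_pos hi]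
      have := one_div_pos.2 (hw ⟨i, hi⟩)
      exact ⟨by simpa using this, ENNReal.ofReal_ne_top⟩
    · simp only [dif_pos hi, dif_pos hi']
      have hw1 := hw ⟨i, hi⟩
      have hw2 := hw ⟨i', hi'⟩
      rw [lengthOf, if_pos ⟨hi, hi'⟩, eval_numExp h hi', eval_denExp h hi']
      by_cases hA : s 6 (i * n + i') = 0
      · simp only [hA, ne_eq, not_true_eq_false, if_false]
        rw [Nat.cast_one, Nat.cast_zero, ENNReal.div_zero one_ne_zero, ENNReal.mul_top]
        · exact le_top
        · simpa using hw1
      · obtain ⟨a, ha, hAa, hxa, hca⟩ := (isArgmin_cell h hi hi').1.resolve_left hA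
        rw [if_pos hA, if_pos hA, hAa, Nat.add_sub_cancel]
        have hxa' : x ⟨a, ha⟩ = ⟨i, hi⟩ := by
          ext
          rw [← hx ⟨a, ha⟩]
          exact hxa
        have hle := hwx ⟨a, ha⟩ ⟨i', hi'⟩
        rw [hxa', ← hinp, ← hinp] at hle
        simp only at hle hca
        rw [← mul_div_assoc, ENNReal.le_div_iff_mul_le (Or.inl (by simpa using hca))
          (Or.inl (by simp)), ← ENNReal.ofReal_natCast, ← ENNReal.ofReal_natCast,
          ← ENNReal.ofReal_mul (by positivity), ← ENNReal.ofReal_mul (by positivity)]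
        refine ENNReal.ofReal_le_ofReal ?_
        rw [div_mul_eq_mul_div, div_mul_eq_mul_div, one_mul, one_mul, div_le_div_iff₀ hw2 hw1]
        linarith

end Check

/-! ### The candidates contain a suitable allocation -/

lemma exists_digits (b : ℕ) (hb : 0 < b) (N : ℕ) (K : ℕ → ℕ) (hK : ∀ l, K l < b) :
    ∃ q < b ^ N, ∀ l < N, q / b ^ l % b = K l := by
  induction N generalizing K with
  | zero => exact ⟨0, by simp, fun l hl => by lia⟩
  | succ N ih =>
    obtain ⟨q, hq, hd⟩ := ih (fun l => K (l + 1)) fun l => hK _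
    have h0 := hK 0
    refine ⟨b * q + K 0, ?_, fun l hl => ?_⟩
    · rw [pow_succ]
      nlinarith
    · cases l with
      | zero => rw [pow_zero, Nat.div_one, Nat.mul_add_mod, Nat.mod_eq_of_lt h0]
      | succ l =>
        rw [pow_succ', ← Nat.div_div_eq_div_mul, Nat.mul_add_div hb, Nat.div_eq_of_lt h0, add_zero]
        exact hd l (by lia)

/-- In the order of the chores by the ratio `a j / b j`, ties being broken by decreasing index, the
last chore of `P` is a threshold between `P` and `Q`. -/
lemma exists_threshold {m : ℕ} (a b : ℕ → ℕ) (P R : ℕ → Prop) (hP : ∀ j, P j → b j ≠ 0)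
    (h : ∀ j < m, P j → ∀ j' < m, R j' →
      a j * b j' < b j * a j' ∨ a j * b j' = b j * a j' ∧ j' < j) :
    ∃ K ≤ m, (∀ j < m, P j →
        K < m ∧ (a j * b K < b j * a K ∨ a j * b K ≤ b j * a K ∧ K ≤ j)) ∧
      ∀ j < m, R j → ¬ (K < m ∧ (a j * b K < b j * a K ∨ a j * b K ≤ b j * a K ∧ K ≤ j)) := by
  classical
  by_cases hne : ((range m).filter P).Nonempty
  · obtain ⟨K, hK, hmax⟩ := exists_max_image ((range m).filter P)
      (fun j => toLex ((a j : ℚ) / b j, OrderDual.toDual j)) hne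
    simp only [mem_filter, mem_range] at hK hmax
    refine ⟨K, hK.1.le, fun j hj hPj => ⟨hK.1, ?_⟩, fun j hj hRj => ?_⟩
    · have hbj : (0 : ℚ) < b j := by exact_mod_cast Nat.pos_of_ne_zero (hP j hPj)
      have hbK : (0 : ℚ) < b K := by exact_mod_cast Nat.pos_of_ne_zero (hP K hK.2)
      have := hmax j ⟨hj, hPj⟩
      rw [Prod.Lex.toLex_le_toLex] at this
      rcases this with hlt | ⟨heq, hle⟩
      · left
        rw [div_lt_div_iff₀ hbj hbK] at hlt
        have : a j * b K < a K * b j := by exact_mod_cast hlt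
        lia
      · right
        simp only at heq
        rw [div_eq_div_iff hbj.ne' hbK.ne'] at heq
        have : a j * b K = a K * b j := by exact_mod_cast heq
        exact ⟨by lia, OrderDual.toDual_le_toDual.1 hle⟩
    · rintro ⟨-, hcon⟩
      have e1 : a K * b j = b j * a K := mul_comm _ _
      have e2 : b K * a j = a j * b K := mul_comm _ _
      have := h K hK.1 hK.2 j hj hRj
      lia
  · refine ⟨m, le_rfl, fun j hj hPj => absurd ⟨j, by simp [hj, hPj]⟩ hne, fun j hj hRj => ?_⟩
    rintro ⟨hlt, -⟩
    exact absurd hlt (lt_irrefl m)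

lemma exists_candidate {n m : ℕ} (inp : ℕ → ℕ) (c : Fin n → Fin m → ℕ)
    (hinp : ∀ (i : Fin n) (j : Fin m), inp (i * m + j) = c i j) (x : Fin m → Fin n) {w : Fin n → ℝ}
    (hw : ∀ i, 0 < w i) (hwx : ∀ j i, w (x j) * c (x j) j ≤ w i * c i j)
    (hzero : ∀ j, (∃ i, c i j = 0) → c (x j) j = 0 ∧ ∀ i < x j, c i j ≠ 0)
    (htie : ∀ j j', (∀ i, c i j ≠ 0) → (∀ i, c i j' ≠ 0) → x j < x j' →
        c (x j) j * c (x j') j' = c (x j') j * c (x j) j' → j' ≤ j) :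
    ∃ q < (m + 1) ^ (n * n), ∀ (j : Fin m) (v : ℕ),
      IsRecipient n m (fun i j => inp (i * m + j)) q j v → v = x j := by
  have hthr : ∀ l : ℕ, ∃ K ≤ m, ∀ i i' : Fin n, l = i * n + i' → i < i' →
      ∀ j : Fin m, (∀ k, c k j ≠ 0) →
        (x j = i → K < m ∧ (inp (i * m + j) * inp (i' * m + K) < inp (i' * m + j) * inp (i * m + K) ∨
          inp (i * m + j) * inp (i' * m + K) ≤ inp (i' * m + j) * inp (i * m + K) ∧ K ≤ j)) ∧
        (x j = i' → ¬ (K < m ∧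
          (inp (i * m + j) * inp (i' * m + K) < inp (i' * m + j) * inp (i * m + K) ∨
          inp (i * m + j) * inp (i' * m + K) ≤ inp (i' * m + j) * inp (i * m + K) ∧ K ≤ j))) := by
    intro l
    by_cases hl : ∃ i i' : Fin n, l = i * n + i' ∧ i < i'
    · obtain ⟨i, i', rfl, hlt⟩ := hl
      obtain ⟨K, hK, h1, h2⟩ := exists_threshold (m := m) (fun j => inp (i * m + j))
        (fun j => inp (i' * m + j))
        (fun j => ∃ hj : j < m, (∀ k, c k ⟨j, hj⟩ ≠ 0) ∧ x ⟨j, hj⟩ = i)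
        (fun j => ∃ hj : j < m, (∀ k, c k ⟨j, hj⟩ ≠ 0) ∧ x ⟨j, hj⟩ = i')
        (by
          rintro j ⟨hj, hpos, -⟩
          have := hinp i' ⟨j, hj⟩
          simp only at this
          rw [this]
          exact hpos i')
        (by
          rintro j - ⟨hj, hpos, hxj⟩ j' - ⟨hj', hpos', hxj'⟩
          have e1 := hinp i ⟨j, hj⟩
          have e2 := hinp i' ⟨j, hj⟩
          have e3 := hinp i ⟨j', hj'⟩
          have e4 := hinp i' ⟨j', hj'⟩
          simp only at e1 e2 e3 e4
          rw [e1, e2, e3, e4]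
          have g1 := hwx ⟨j, hj⟩ i'
          have g2 := hwx ⟨j', hj'⟩ i
          rw [hxj] at g1
          rw [hxj'] at g2
          have hle : c i ⟨j, hj⟩ * c i' ⟨j', hj'⟩ ≤ c i' ⟨j, hj⟩ * c i ⟨j', hj'⟩ := by
            have hmul := mul_le_mul g1 g2 (by have := hw i'; positivity)
              (by have := hw i'; positivity)
            have hww := mul_pos (hw i) (hw i')
            have : w i * w i' * ((c i ⟨j, hj⟩ * c i' ⟨j', hj'⟩ : ℕ) : ℝ) ≤
                w i * w i' * ((c i' ⟨j, hj⟩ * c i ⟨j', hj'⟩ : ℕ) : ℝ) := by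
              push_cast
              linarith
            exact_mod_cast le_of_mul_le_mul_left this hww
          rcases hle.lt_or_eq with h | h
          · exact Or.inl h
          · refine Or.inr ⟨h, ?_⟩
            have hjj := htie ⟨j, hj⟩ ⟨j', hj'⟩ hpos hpos' (by rw [hxj, hxj']; exact hlt)
              (by rw [hxj, hxj']; exact h)
            have hjj' : j' ≤ j := hjj
            rcases hjj'.lt_or_eq with h' | rfl
            · exact h'
            · exact absurd (hxj.symm.trans hxj') hlt.ne)
      refine ⟨K, hK, fun k k' hkk _ j hpos => ?_⟩
      have h3 := cell_div_mod (i := i) i'.2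
      have h4 := cell_div_mod (i := k) k'.2
      rw [← hkk] at h4
      obtain rfl : i = k := Fin.ext (h3.1.symm.trans h4.1)
      obtain rfl : i' = k' := Fin.ext (h3.2.symm.trans h4.2)
      exact ⟨fun hxj => h1 j j.2 ⟨j.2, hpos, hxj⟩, fun hxj => h2 j j.2 ⟨j.2, hpos, hxj⟩⟩
    · exact ⟨0, Nat.zero_le _, fun i i' h1 h2 => absurd ⟨i, i', h1, h2⟩ hl⟩
  choose K hK hside using hthr
  obtain ⟨q, hq, hdig⟩ := exists_digits (m + 1) m.succ_pos (n * n) K fun l =>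
    Nat.lt_succ_of_le (hK l)
  refine ⟨q, hq, fun j v ⟨hv, hv0, hvb⟩ => ?_⟩
  by_cases hpos : ∀ i, c i j ≠ 0
  · refine (hvb (fun i hi => ?_) (x j) (x j).2 fun i' hi' => ⟨fun hlt => ?_, fun hlt => ?_⟩)
    · have := hinp ⟨i, hi⟩ j
      simp only at this ⊢
      rw [this]
      exact hpos _
    · have := (hside _ (x j) ⟨i', hi'⟩ rfl hlt j hpos).1 rfl
      simp only at this
      unfold Side
      rw [hdig _ (cell_lt (x j).2 hi')]
      exact this
    · have := (hside _ ⟨i', hi'⟩ (x j) rfl hlt j hpos).2 rfl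
      simp only at this
      unfold Side
      rw [hdig _ (cell_lt hi' (x j).2)]
      exact this
  · push Not at hpos
    obtain ⟨h1, h2⟩ := hzero j hpos
    obtain ⟨k, hk⟩ := hpos
    obtain ⟨h3, h4⟩ := hv0 ⟨k, k.2, by simp only [hinp]; exact hk⟩
    rcases lt_trichotomy v (x j) with hlt | heq | hgt
    · have := hinp ⟨v, hv⟩ j
      simp only at this h3
      exact absurd (this.symm.trans h3) (h2 ⟨v, hv⟩ hlt)
    · exact heq
    · have := h4 _ hgt
      simp only [hinp] at this
      exact absurd h1 this

end ChoreDivision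

/-! ### The running time -/

namespace ChoreDivision

open RAM RAM.Exp Finset

lemma inputState_cost {n m : ℕ} (c : Fin n → Fin m → ℕ) (i : Fin n) (j : Fin m) :
    inputState c 1 (i * m + j) = c i j := by
  have hm : 0 < m := j.pos
  have hlt : (i : ℕ) * m + j < n * m := by
    have := Nat.mul_le_mul_right m (Nat.succ_le_of_lt i.2)
    have := j.2
    rw [Nat.succ_mul] at *
    lia
  simp only [inputState, if_neg one_ne_zero, if_true, dif_pos hlt]
  congr 1
  · ext
    simp only [Fin.coe_divNat]
    rw [mul_comm, Nat.mul_add_div hm, Nat.div_eq_of_lt j.2, add_zero]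
  · ext
    simp only [Fin.coe_modNat]
    rw [mul_comm, Nat.mul_add_mod, Nat.mod_eq_of_lt j.2]

lemma size_inputState_le {n m : ℕ} (c : Fin n → Fin m → ℕ) (a k : ℕ) :
    (inputState c a k).size ≤ inputSize c := by
  have hc : ∀ i j, (c i j).size ≤ inputSize c := by
    intro i j
    have h1 := single_le_sum (s := univ) (f := fun j => (c i j).size + 1) (fun _ _ => Nat.zero_le _)
      (mem_univ j)
    have h2 := single_le_sum (s := univ) (f := fun i => ∑ j, ((c i j).size + 1))
      (fun _ _ => Nat.zero_le _) (mem_univ i)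
    unfold inputSize
    lia
  unfold inputState
  split_ifs
  · unfold inputSize; lia
  · simp
  · exact hc _ _
  · simp
  · simp

lemma card_le_inputSize {n m : ℕ} (hn : 1 ≤ n) (c : Fin n → Fin m → ℕ) : m ≤ inputSize c := by
  have h1 : m ≤ ∑ j, ((c ⟨0, hn⟩ j).size + 1) := by
    rw [sum_add_distrib]
    simp
  have h2 := single_le_sum (s := univ) (f := fun i => ∑ j, ((c i j).size + 1))
    (fun _ _ => Nat.zero_le _) (mem_univ ⟨0, hn⟩)
  unfold inputSize
  lia

lemma sizeBound_inputState {n m Q : ℕ} (c : Fin n → Fin m → ℕ) (hQ : Q < (m + 1) ^ (n * n)) :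
    SizeBound n m (inputState c 1) Q ((n * n + 2) * (inputSize c + 1) + n) := by
  have hm : m.size ≤ inputSize c := by unfold inputSize; lia
  have hsq := Nat.zero_le (n * n * inputSize c)
  constructor
  · have := Nat.size_le.2 (Nat.lt_two_pow_self (n := n))
    lia
  · nlinarith
  · have h1 : m + 1 ≤ 2 ^ inputSize c := Nat.succ_le_of_lt (Nat.size_le.1 hm)
    have h2 : Q < 2 ^ (inputSize c * (n * n)) := by
      rw [pow_mul]
      exact hQ.trans_le (Nat.pow_le_pow_left h1 _)
    have := Nat.size_le.2 h2
    nlinarith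
  · intro k
    have := size_inputState_le c 1 k
    nlinarith
  · intro i
    have h1 : ∑ j ∈ range m, inputState c 1 (i * m + j) ≤ m * 2 ^ inputSize c := by
      refine (sum_le_card_nsmul _ _ (2 ^ inputSize c) fun j _ => ?_).trans (by simp)
      exact (Nat.size_le.1 (size_inputState_le c 1 _)).le
    have h2 := Nat.size_le_size h1
    have h3 := size_mul_le m (2 ^ inputSize c)
    rw [Nat.size_pow] at h3
    nlinarith

lemma inv_inputState {n m Q : ℕ} (c : Fin n → Fin m → ℕ) :
    Inv n m (inputState c 1) Q ((n * n + 2) * (inputSize c + 1) + n) (0, 0) (inputState c) := by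
  refine ⟨by simp [inputState], rfl, by simp [inputState], by simp [inputState], Nat.zero_le _,
    Nat.zero_le _, fun j hj => absurd hj (Nat.not_lt_zero _), fun l _ => by simp [inputState],
    fun l _ => ⟨fun j hj => absurd hj (Nat.not_lt_zero _), Or.inl (by simp [inputState])⟩,
    fun l _ => ⟨Or.inl (by simp [inputState]), fun j hj => absurd hj (Nat.not_lt_zero _)⟩,
    fun a k => ?_⟩
  have := size_inputState_le c a k
  nlinarith [Nat.zero_le (n * n * inputSize c)]

/-- If candidate number `Q` is suitable, the program finds an EF1 and Pareto optimal allocation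
after at most `(Q + 1) * (m + 1)` rounds. -/
lemma exists_exec_program (n : ℕ) (hn : 0 < n) : ∃ K, ∀ (m : ℕ) (c : Fin n → Fin m → ℕ) (Q : ℕ)
    (_ : Q < (m + 1) ^ (n * n)) (_ : ∀ s B, Inv n m (inputState c 1) Q B (Q, m) s →
      (checkExp n).eval s ≠ 0),
    ∃ (t : State) (x : Fin m → Fin n),
      (∃ T ≤ K * ((n * n + 2) * (inputSize c + 1) + n + 1) * ((Q + 1) * (m + 1)),
        Exec (.loop (guardExp n) (bodyProgram n)) (inputState c) t T) ∧
      IsOutput t x ∧ IsEF1 c x ∧ IsPO c x := by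
  obtain ⟨K, hK⟩ := exists_exec_loop (guardExp n) (loopFree_bodyProgram n)
  refine ⟨K, fun m c Q hQ hcheck => ?_⟩
  set B := (n * n + 2) * (inputSize c + 1) + n with hB
  have hguard : ∀ p s, Inv n m (inputState c 1) Q B p s →
      ((lt curExp choresExp).eval s ≠ 0 ↔ p.2 < m) := by
    intro p s h
    rw [eval_lt]
    have h1 : curExp.eval s = p.2 := h.cur
    have h2 : choresExp.eval s = m := h.chores
    rw [h1, h2]
    simp
  obtain ⟨⟨q, j⟩, t, hI, hg, T, hT, hE⟩ := hK B (ℕ × ℕ) (Inv n m (inputState c 1) Q B)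
    (fun p => (Q - p.1) * (m + 1) + (m - p.2)) (fun p s h => h.bounded) (by
      rintro ⟨q, j⟩ s h hg
      by_cases hj : j < m
      · refine ⟨(q, j + 1), by simp only; lia, ?_⟩
        rw [bodyProgram, Program.run, if_pos ((hguard _ s h).2 hj)]
        exact h.chorePart hn (sizeBound_inputState c hQ) hj
      · have hjm : j = m := le_antisymm h.cur_le (not_lt.1 hj)
        subst hjm
        have hc : (checkExp n).eval s = 0 := by
          by_contra hc
          apply hg
          have h1 : (lt curExp choresExp).eval s = 0 := by
            by_contra h1
            exact hj ((hguard _ s h).1 h1)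
          simp [guardExp, Exp.eval, eval_not, hc, h1]
        have hqQ : q < Q := by
          refine lt_of_le_of_ne h.cand_le fun heq => ?_
          subst heq
          exact hcheck s B h hc
        refine ⟨(q + 1, 0), ?_, ?_⟩
        · simp only
          obtain ⟨r, hr⟩ : ∃ r, Q - q = r + 1 := ⟨Q - q - 1, by lia⟩
          have : Q - (q + 1) = r := by lia
          rw [this, hr, Nat.succ_mul]
          lia
        · rw [bodyProgram, Program.run, if_neg (fun h1 => hj ((hguard _ s h).1 h1))]
          exact h.candidatePart (sizeBound_inputState c hQ) hqQ) (0, 0) _ (inv_inputState c)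
  simp only [guardExp, Exp.eval, Nat.add_eq_zero_iff, eval_not] at hg
  have hj : j = m := by
    refine le_antisymm hI.cur_le (not_lt.1 fun h => ?_)
    exact (hguard _ t hI).2 h hg.1
  subst hj
  have hc : (checkExp n).eval t ≠ 0 := by
    intro hc
    simp [hc] at hg
  have hx : ∀ k : Fin j, t 2 k < n := fun k => (hI.recipient k k.2).1
  refine ⟨t, fun k => ⟨t 2 k, hx k⟩, ⟨T, hT.trans ?_, hE⟩, fun k => rfl,
    isEF1_of_check hI (inputState_cost c) (fun k => rfl) hc,
    isPO_of_check hI (inputState_cost c) (fun k => rfl) hc⟩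
  gcongr
  simp only [Nat.sub_zero]
  lia

end ChoreDivision

theorem theorem3 (n : ℕ) (hn : 1 ≤ n) :
    ∃ (P : RAM.Program) (p : Polynomial ℕ), ∀ (m : ℕ) (c : Fin n → Fin m → ℕ),
      ∃ (t : RAM.State) (T : ℕ) (x : Fin m → Fin n),
        RAM.Exec P (ChoreDivision.inputState c) t T ∧
        T ≤ p.eval (ChoreDivision.inputSize c) ∧
        ChoreDivision.IsOutput t x ∧
        ChoreDivision.IsEF1 c x ∧
        ChoreDivision.IsPO c x := by
  obtain ⟨d, rfl⟩ : ∃ d, n = d + 1 := ⟨n - 1, by lia⟩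
  set n := d + 1 with hnd
  obtain ⟨K, hK⟩ := ChoreDivision.exists_exec_program n hn
  refine ⟨.loop (ChoreDivision.guardExp n) (ChoreDivision.bodyProgram n),
    .C K * (.C (n * n + 2) * (.X + 1) + .C n + 1) * ((.X + 1) ^ (n * n) * (.X + 1)), fun m c => ?_⟩
  obtain ⟨w, x, hw, hwx, hzero, hef, htie⟩ := ChoreDivision.exists_supported_ef1 c
  obtain ⟨Q, hQ, hrec⟩ := ChoreDivision.exists_candidate _ c (ChoreDivision.inputState_cost c) x hw
    hwx hzero htie
  obtain ⟨t, y, ⟨T, hT, hE⟩, hout, hEF1, hPO⟩ := hK m c Q hQ fun s B h =>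
    ChoreDivision.check_of_supported h (ChoreDivision.inputState_cost c)
      (fun j => hrec j _ (h.recipient j j.2)) hw hwx hef
  refine ⟨t, T, y, hE, hT.trans ?_, hout, hEF1, hPO⟩
  simp only [Polynomial.eval_mul, Polynomial.eval_add, Polynomial.eval_pow, Polynomial.eval_C,
    Polynomial.eval_X, Polynomial.eval_one]
  have hm := ChoreDivision.card_le_inputSize hn c
  have hQ' : Q + 1 ≤ (ChoreDivision.inputSize c + 1) ^ (n * n) :=
    (Nat.succ_le_of_lt hQ).trans (Nat.pow_le_pow_left (by lia) _)
  gcongr
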